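/- Let $\sigma>0$, let $k_\sigma(x,y)=\exp\bigl(-\|x-y\|_2^2/(2\sigma^2)\bigr)$ be the Gaussian kernel on $\mathbb{R}^d$, and let $\phi$ be any feature map of it, i.e. a map from $\mathbb{R}^d$ into a real Hilbert space $H$ with $k_\sigma(x,y)=\langle\phi(x),\phi(y)\rangle$ for all $x,y$. For a random vector $\mathbf{X}$ in $\mathbb{R}^d$ let $C_{\mathbf{X}}=\mathbb{E}[\phi(\mathbf{X})\phi(\mathbf{X})^\top]$ be its kernel covariance operator on $H$, and for $\eta\ge 1$ let $\Lambda_{\mathbf{X}|\eta\mathbf{Y}}=C_{\mathbf{X}}-\eta\, C_{\mathbf{Y}}$. Let $\mathbf{X}\sim\sum_{i=1}^k\omega_iP_i$ and $\mathbf{Y}\sim\sum_{i=1}^k\gamma_iQ_i$, where $P_i,Q_i$ are probability distributions on $\mathbb{R}^d$, $\omega_i,\gamma_i\ge 0$, $\sum_i\omega_i=\sum_i\gamma_i=1$, and $\omega_1-\eta\gamma_1\ge\cdots\ge\omega_k-\eta\gamma_k$. Let $\mu_i$ be the mean of $P_i$ and $\mu_i'=\mu_i+\delta_i$ the mean of $Q_i$,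 and assume that for every $i$ the total variances satisfy $\mathbb{E}_{\mathbf{Z}\sim P_i}\|\mathbf{Z}-\mu_i\|_2^2\le\sigma_i^2$ and $\mathbb{E}_{\mathbf{Z}\sim Q_i}\|\mathbf{Z}-\mu_i'\|_2^2\le\sigma_i^2$. Then the positive eigenvalues of $\Lambda_{\mathbf{X}|\eta\mathbf{Y}}$, counted with multiplicity, can be listed in descending order as $\lambda_1\ge\lambda_2\ge\cdots>0$ (finitely or infinitely many), and, setting $\lambda_i=0$ for every $i$ beyond the number of positive eigenvalues, $$\sum_{i=1}^k\Bigl(\lambda_i-\max\{\omega_i-\eta\gamma_i,0\}\Bigr)^2\le 8\sum_{i=1}^k\Bigl[\omega_i\frac{\|\delta_i\|_2^2}{\sigma^2}+(\omega_i+\eta^2\gamma_i)\frac{\sigma_i^2}{\sigma^2}\Bigr]+16(1+\eta)\sum_{i=2}^k\sum_{j=1}^{i-1}(\omega_i+\eta\gamma_i)\exp\Bigl(\frac{-\|\mu_i'-\mu_j'\|_2^2}{\sigma^2}\Bigr).$$ -/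

import Mathlib

open MeasureTheory
open scoped ENNReal InnerProductSpace

/-- The normalized Gaussian kernel with bandwidth `σ` on `ℝᵈ` (Euclidean norm). -/
noncomputable def gaussianKernel {d : ℕ} (σ : ℝ) (x y : EuclideanSpace ℝ (Fin d)) : ℝ :=
  Real.exp (-‖x - y‖ ^ 2 / (2 * σ ^ 2))

/-- `φ` is a feature map of the kernel `κ`: `κ x y = ⟪φ x, φ y⟫`. -/
def IsFeatureMap {E H : Type*} [NormedAddCommGroup H] [InnerProductSpace ℝ H]
    (κ : E → E → ℝ) (φ : E → H) : Prop :=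
  ∀ x y, κ x y = ⟪φ x, φ y⟫_ℝ

/-- The kernel covariance operator `C = 𝔼_{X ∼ P}[φ(X) φ(X)ᵀ]`, where `a aᵀ` is the rank-one
operator `v ↦ ⟪a, v⟫ a` and the expectation is a Bochner integral in operator norm. -/
noncomputable def kernelCovariance {E H : Type*} [MeasurableSpace E] [NormedAddCommGroup H]
    [InnerProductSpace ℝ H] (φ : E → H) (P : Measure E) : H →L[ℝ] H :=
  ∫ x, InnerProductSpace.rankOne ℝ (φ x) (φ x) ∂P

/-- The `η`-differential kernel covariance operator `Λ = C_X - η C_Y` of laws `P` of `X` and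
`Q` of `Y`. -/
noncomputable def diffKernelCovariance {E H : Type*} [MeasurableSpace E] [NormedAddCommGroup H]
    [InnerProductSpace ℝ H] (φ : E → H) (η : ℝ) (P Q : Measure E) : H →L[ℝ] H :=
  kernelCovariance φ P - η • kernelCovariance φ Q

/-- The mixture `∑ i, ω i • P i`. -/
noncomputable def mixture {E : Type*} [MeasurableSpace E] {k : ℕ} (ω : Fin k → ℝ)
    (P : Fin k → Measure E) : Measure E :=
  ∑ i, ENNReal.ofReal (ω i) • P i

/-- `ω` is a probability vector. -/
def IsProbVector {k : ℕ} (ω : Fin k → ℝ) : Prop :=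
  (∀ i, 0 ≤ ω i) ∧ ∑ i, ω i = 1

/-- The mean vector of a distribution. -/
noncomputable def meanVector {d : ℕ} (P : Measure (EuclideanSpace ℝ (Fin d))) :
    EuclideanSpace ℝ (Fin d) :=
  ∫ x, x ∂P

/-- The total variance `𝔼‖X - 𝔼 X‖²` (the trace of the covariance matrix), as an extended
nonnegative real; if it is finite for a probability measure, the mean is that of an integrable
function. -/
noncomputable def totalVariance {d : ℕ} (P : Measure (EuclideanSpace ℝ (Fin d))) : ℝ≥0∞ :=
  ∫⁻ x, ‖x - meanVector P‖ₑ ^ 2 ∂P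

/-- `lam 0 ≥ lam 1 ≥ …` lists the positive eigenvalues of `T` in descending order, each repeated
as often as the dimension of its eigenspace, followed by zeros when there are only finitely many
of them. -/
def IsPosEigenvalueSeq {H : Type*} [NormedAddCommGroup H] [InnerProductSpace ℝ H]
    (T : H →L[ℝ] H) (lam : ℕ → ℝ) : Prop :=
  Antitone lam ∧ (∀ n, 0 ≤ lam n) ∧
    ∀ t : ℝ, 0 < t → {n | lam n = t}.encard =
      Cardinal.toENat (Module.rank ℝ (Module.End.eigenspace (T : H →ₗ[ℝ] H) t))

/-- The Gaussian kernel has a feature map into a Hilbert space. -/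
theorem exists_isFeatureMap_gaussianKernel {d : ℕ} {σ : ℝ} (hσ : 0 < σ) :
    ∃ φ : EuclideanSpace ℝ (Fin d) →
        Lp ℝ 2 (volume : Measure (EuclideanSpace ℝ (Fin d))),
      IsFeatureMap (gaussianKernel σ) φ := by
  set E := EuclideanSpace ℝ (Fin d)
  set f : E → E → ℝ := fun x z => Real.exp (-(1 / σ ^ 2) * ‖z - x‖ ^ 2) with hf
  have hint : ∀ c : ℝ, 0 < c → Integrable (fun z : E => Real.exp (-c * ‖z‖ ^ 2)) := by
    intro c hc
    have := (GaussianFourier.integrable_cexp_neg_mul_sq_norm_add (V := E) (b := (c : ℂ))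
      (by simpa using hc) 0 0).norm
    refine this.congr (Filter.Eventually.of_forall fun z => ?_)
    simp [Complex.norm_exp, ← Complex.ofReal_pow]
  have hpar : ∀ x y z : E, f x z * f y z =
      gaussianKernel σ x y * Real.exp (-(2 / σ ^ 2) * ‖z - (2⁻¹ : ℝ) • (x + y)‖ ^ 2) := by
    intro x y z
    have h1 := parallelogram_law_with_norm ℝ (z - x) (z - y)
    have h2 : (z - x) + (z - y) = (2 : ℝ) • (z - (2⁻¹ : ℝ) • (x + y)) := by module
    have h3 : (z - x) - (z - y) = -(x - y) := by abel
    rw [h2, h3, norm_smul, norm_neg] at h1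
    simp only [Real.norm_ofNat] at h1
    simp only [hf, gaussianKernel, ← Real.exp_add]
    congr 1
    field_simp
    nlinarith
  have hmem : ∀ x, MemLp (f x) 2 (volume : Measure E) := by
    intro x
    have hc : Continuous (f x) := by fun_prop
    rw [memLp_two_iff_integrable_sq hc.aestronglyMeasurable]
    have := (hint (2 / σ ^ 2) (by positivity)).comp_sub_right x
    refine this.congr (Filter.Eventually.of_forall fun z => ?_)
    simp only [hf, ← Real.exp_nat_mul]
    congr 1
    push_cast
    ring
  set I : ℝ := ∫ z : E, Real.exp (-(2 / σ ^ 2) * ‖z‖ ^ 2) with hI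
  have hIpos : 0 < I := integral_exp_pos (hint (2 / σ ^ 2) (by positivity))
  refine ⟨fun x => (√I)⁻¹ • (hmem x).toLp (f x), fun x y => ?_⟩
  rw [real_inner_smul_left, real_inner_smul_right, L2.inner_def]
  have h1 : ∫ z, ⟪(hmem x).toLp (f x) z, (hmem y).toLp (f y) z⟫_ℝ = ∫ z, f x z * f y z := by
    refine integral_congr_ae ?_
    filter_upwards [(hmem x).coeFn_toLp, (hmem y).coeFn_toLp] with z hx hy
    rw [hx, hy]
    simp [mul_comm]
  rw [h1]
  simp_rw [hpar]
  rw [integral_const_mul,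
    integral_sub_right_eq_self (fun z : E => Real.exp (-(2 / σ ^ 2) * ‖z‖ ^ 2)), ← hI]
  rw [← mul_assoc, ← mul_inv, Real.mul_self_sqrt hIpos.le]
  field_simp

/-!
Symmetric Hilbert–Schmidt operators are handled as elements of the inner product space `H ⊗ H`, in
which `v ⊗ v` stands for the rank-one operator `v vᵀ` and `⟪v ⊗ v, w ⊗ w⟫ = ⟪v, w⟫²`. Write
`c i = ω i - η γ i`, `ψ i = φ (μ' i)`, `A = ∑ (c i)⁺ ψ i ψ iᵀ` and `B = ∑ (c i)⁻ ψ i ψ iᵀ`, and let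
`Λ` be the differential covariance operator.

The operator `Λ` is Hilbert–Schmidt close to `A - B`. Indeed
`‖φ x φ xᵀ - φ a φ aᵀ‖² = 2 - 2 exp (-‖x - a‖² / σ²) ≤ 2 ‖x - a‖² / σ²`, so the distance is governed
by the second moments of the components about the points `μ' i`
(`IsFeatureMap.mul_integral_inner_sub_le`).

The positive part `p` of `Λ` is close to `A`. Up to the error just bounded, `p` is the positive part
of `A - B`, which is the metric projection of `A - B` onto the cone of positive operators, and this
gives `‖p - A‖² ≤ ⟪A, B⟫` (`norm_sum_tmul_self_sub_sq_le`). Since `c` is nonincreasing, `⟪A, B⟫`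
involves only the terms `exp (-‖μ' i - μ' j‖² / σ²)` with `j < i`.

The eigenvalues of `A` are close to the weights `(c i)⁺`: the nonzero spectrum of `A` is that of the
weighted Gram matrix `(√((c i)⁺ (c j)⁺) ⟪ψ i, ψ j⟫)`, whose diagonal consists of these weights
(`exists_spectral_decomposition_sum_smul_tmul_self`).

Both comparisons of spectra, of `p` with `A` and of the Gram matrix with its diagonal, are instances
of the Hoffman–Wielandt inequality (`sum_sub_sq_le_of_isWeightedOrthonormal`), a rearrangement
inequality for the doubly substochastic matrix of squared inner products of eigenvectors. As there
may be infinitely many positive eigenvalues, `p` is cut off at finitely many of them. The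
quadratic form of `Λ` exceeds that of the truncation by at most `ε ‖v‖²` at a vector `v`
(`IsWeightedOrthonormal.inner_apply_le`, from the spectral theorem for compact operators), and `ε`
tends to zero because the trace of the covariance operator of a feature map into the unit sphere
is `1`.
-/

open scoped TensorProduct

/-! ### Rearrangement for doubly substochastic matrices -/

/-- **Abel summation**: a nonincreasing nonnegative weight preserves nonnegativity of all partial
sums. -/
theorem sum_antitone_mul_nonneg {n : ℕ} {a z : Fin n → ℝ} (ha : Antitone a) (ha0 : ∀ i, 0 ≤ a i)
    (hz : ∀ m : ℕ, 0 ≤ ∑ i : Fin n, if (i : ℕ) < m then z i else 0) : 0 ≤ ∑ i, a i * z i := by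
  induction n with
  | zero => simp
  | succ n ih =>
    have key : ∑ i, a i * z i =
        ∑ i : Fin n, (a i.castSucc - a (Fin.last n)) * z i.castSucc + a (Fin.last n) * ∑ i, z i := by
      rw [Fin.sum_univ_castSucc, Fin.sum_univ_castSucc z, mul_add, Finset.mul_sum, ← add_assoc,
        ← Finset.sum_add_distrib]
      congr 1
      exact Finset.sum_congr rfl fun i _ => by ring
    have htot : 0 ≤ ∑ i, z i := by
      have := hz (n + 1)
      rwa [Finset.sum_congr rfl fun i _ => if_pos i.2] at this
    rw [key]
    refine add_nonneg (ih (fun i j hij => ?_) (fun i => ?_) fun m => ?_)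
      (mul_nonneg (ha0 _) htot)
    · have := ha (Fin.castSucc_le_castSucc_iff.2 hij)
      linarith
    · have := ha (Fin.le_last i.castSucc)
      linarith
    · have h := hz (min m n)
      rw [Fin.sum_univ_castSucc] at h
      simpa using h

/-- The rearrangement inequality for a doubly substochastic matrix `S` and two nonincreasing
nonnegative sequences. -/
theorem sum_mul_mul_substochastic_le {N k : ℕ} (hkN : k ≤ N) {a : Fin N → ℝ} {g : Fin k → ℝ}
    (ha : Antitone a) (ha0 : ∀ i, 0 ≤ a i) (hg : Antitone g) (hg0 : ∀ j, 0 ≤ g j)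
    {S : Fin N → Fin k → ℝ} (hS : ∀ i j, 0 ≤ S i j) (hrow : ∀ i, ∑ j, S i j ≤ 1)
    (hcol : ∀ j, ∑ i, S i j ≤ 1) :
    ∑ i, ∑ j, a i * g j * S i j ≤ ∑ j, a (Fin.castLE hkN j) * g j := by
  have hcard : ∀ m n : ℕ, (∑ i : Fin m, if (i : ℕ) < n then (1 : ℝ) else 0) = min m n := by
    intro m n
    rw [Finset.sum_boole, Fin.card_filter_val_lt]
  have hembed : ∀ f : Fin k → ℝ,
      ∑ j, f j = ∑ i : Fin N, if h : (i : ℕ) < k then f ⟨i, h⟩ else 0 := by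
    intro f
    have h1 := Fin.sum_univ_eq_sum_range (fun i => if h : i < k then f ⟨i, h⟩ else 0) N
    have h2 := Fin.sum_univ_eq_sum_range (fun i => if h : i < k then f ⟨i, h⟩ else 0) k
    rw [h1]
    simp only [Fin.is_lt, dite_true] at h2
    rw [h2]
    refine Finset.sum_subset (by simpa using hkN) fun i _ hi => ?_
    rw [dif_neg (by simpa using hi)]
  set z : Fin N → ℝ := fun i =>
    (if h : (i : ℕ) < k then g ⟨i, h⟩ else 0) - ∑ j, g j * S i j with hz
  suffices h : 0 ≤ ∑ i, a i * z i by
    have e1 : ∑ j, a (Fin.castLE hkN j) * g j =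
        ∑ i, a i * (if h : (i : ℕ) < k then g ⟨i, h⟩ else 0) := by
      rw [hembed]
      refine Finset.sum_congr rfl fun i _ => ?_
      split_ifs
      · rfl
      · simp
    have e2 : ∑ i, ∑ j, a i * g j * S i j = ∑ i, a i * ∑ j, g j * S i j := by
      simp_rw [Finset.mul_sum, mul_assoc]
    rw [e1, e2, ← sub_nonneg, ← Finset.sum_sub_distrib]
    simpa only [hz, mul_sub] using h
  refine sum_antitone_mul_nonneg ha ha0 fun m => ?_
  have e3 : (∑ i : Fin N, if (i : ℕ) < m then z i else 0) =
      ∑ j, g j * ((if (j : ℕ) < m then 1 else 0) - ∑ i : Fin N, if (i : ℕ) < m then S i j else 0) := by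
    have : ∀ i : Fin N, (if (i : ℕ) < m then z i else 0) =
        (if h : (i : ℕ) < k then g ⟨i, h⟩ * (if (i : ℕ) < m then 1 else 0) else 0) -
          ∑ j, g j * (if (i : ℕ) < m then S i j else 0) := by
      intro i
      split_ifs <;> simp_all
    simp_rw [this, mul_sub, Finset.sum_sub_distrib, Finset.mul_sum]
    rw [hembed, Finset.sum_comm]
  rw [e3]
  refine sum_antitone_mul_nonneg hg hg0 fun n => ?_
  have e4 : (∑ j : Fin k, if (j : ℕ) < n then ((if (j : ℕ) < m then (1 : ℝ) else 0) -
      ∑ i : Fin N, if (i : ℕ) < m then S i j else 0) else 0) =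
      min k (min n m : ℕ) - ∑ j : Fin k, if (j : ℕ) < n then
        ∑ i : Fin N, (if (i : ℕ) < m then S i j else 0) else 0 := by
    rw [← hcard, ← Finset.sum_sub_distrib]
    refine Finset.sum_congr rfl fun j _ => ?_
    simp only [lt_inf_iff]
    split_ifs <;> simp_all
  rw [e4, sub_nonneg]
  have b1 : (∑ j : Fin k, if (j : ℕ) < n then
      ∑ i : Fin N, (if (i : ℕ) < m then S i j else 0) else 0) ≤ (min k n : ℕ) := by
    rw [← hcard]
    refine Finset.sum_le_sum fun j _ => ?_
    split_ifs
    · refine le_trans (Finset.sum_le_sum fun i _ => ?_) (hcol j)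
      split_ifs
      · exact le_rfl
      · exact hS i j
    · exact le_rfl
  have b2 : (∑ j : Fin k, if (j : ℕ) < n then
      ∑ i : Fin N, (if (i : ℕ) < m then S i j else 0) else 0) ≤ (min N m : ℕ) := by
    rw [← hcard]
    have : ∀ j : Fin k, (if (j : ℕ) < n then
        ∑ i : Fin N, (if (i : ℕ) < m then S i j else 0) else 0) ≤
          ∑ i : Fin N, (if (i : ℕ) < m then S i j else 0) := by
      intro j
      split_ifs
      · exact le_rfl
      · exact Finset.sum_nonneg fun i _ => by split_ifs <;> simp [hS]
    refine (Finset.sum_le_sum fun j _ => this j).trans ?_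
    rw [Finset.sum_comm]
    refine Finset.sum_le_sum fun i _ => ?_
    split_ifs
    · exact hrow i
    · simp
  rcases le_total (min k n) (min N m) with h | h
  · refine b1.trans ?_
    exact_mod_cast (by omega : min k n ≤ min k (min n m))
  · refine b2.trans ?_
    exact_mod_cast (by omega : min N m ≤ min k (min n m))

/-! ### Finite-rank operators and the Hoffman–Wielandt inequality -/

/-- `e` consists of pairwise orthogonal unit vectors, except that `e i` is the zero vector at some
of the indices where the weight `a i` vanishes. -/
def IsWeightedOrthonormal {ι H : Type*} [NormedAddCommGroup H] [InnerProductSpace ℝ H]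
    (a : ι → ℝ) (e : ι → H) : Prop :=
  (∀ i j, i ≠ j → ⟪e i, e j⟫_ℝ = 0) ∧ ∀ i, ‖e i‖ = 1 ∨ (a i = 0 ∧ e i = 0)

section
variable {H : Type*} [NormedAddCommGroup H] [InnerProductSpace ℝ H]

theorem Orthonormal.isWeightedOrthonormal {ι : Type*} {e : ι → H} (he : Orthonormal ℝ e)
    (a : ι → ℝ) : IsWeightedOrthonormal a e :=
  ⟨fun _ _ hij => he.2 hij, fun i => Or.inl (he.1 i)⟩

namespace IsWeightedOrthonormal
variable {ι : Type*} {a : ι → ℝ} {e : ι → H}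

theorem comp {κ : Type*} {f : κ → ι} (he : IsWeightedOrthonormal a e) (hf : Function.Injective f) :
    IsWeightedOrthonormal (a ∘ f) (e ∘ f) :=
  ⟨fun _ _ hij => he.1 _ _ (hf.ne hij), fun i => he.2 (f i)⟩

theorem norm_le_one (he : IsWeightedOrthonormal a e) (i : ι) : ‖e i‖ ≤ 1 := by
  rcases he.2 i with h | ⟨-, h⟩ <;> simp [h]

theorem weight_mul_norm_sq (he : IsWeightedOrthonormal a e) (i : ι) :
    a i * ‖e i‖ ^ 2 = a i := by
  rcases he.2 i with h | ⟨h, -⟩ <;> simp [h]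

theorem inner_self_mul (he : IsWeightedOrthonormal a e) (i : ι) (v : H) :
    ⟪e i, v⟫_ℝ * ⟪e i, e i⟫_ℝ = ⟪e i, v⟫_ℝ := by
  rcases he.2 i with h | ⟨-, h⟩
  · rw [real_inner_self_eq_norm_sq, h]
    ring
  · simp [h]

theorem inner_sum_smul (he : IsWeightedOrthonormal a e) (s : Finset ι) {i : ι} (hi : i ∈ s)
    (v : H) : ⟪e i, ∑ j ∈ s, ⟪e j, v⟫_ℝ • e j⟫_ℝ = ⟪e i, v⟫_ℝ := by
  rw [inner_sum, Finset.sum_eq_single_of_mem i hi fun j _ hj => ?_, real_inner_smul_right,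
    he.inner_self_mul]
  rw [real_inner_smul_right, he.1 _ _ hj.symm, mul_zero]

/-- The Pythagorean identity behind Bessel's inequality. -/
theorem norm_sub_sum_sq (he : IsWeightedOrthonormal a e) (s : Finset ι) (v : H) :
    ‖v - ∑ j ∈ s, ⟪e j, v⟫_ℝ • e j‖ ^ 2 = ‖v‖ ^ 2 - ∑ j ∈ s, ⟪e j, v⟫_ℝ ^ 2 := by
  have h1 : ⟪v, ∑ j ∈ s, ⟪e j, v⟫_ℝ • e j⟫_ℝ = ∑ j ∈ s, ⟪e j, v⟫_ℝ ^ 2 := by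
    rw [inner_sum]
    refine Finset.sum_congr rfl fun j _ => ?_
    rw [real_inner_smul_right, real_inner_comm]
    ring
  have h2 : ‖∑ j ∈ s, ⟪e j, v⟫_ℝ • e j‖ ^ 2 = ∑ j ∈ s, ⟪e j, v⟫_ℝ ^ 2 := by
    rw [← real_inner_self_eq_norm_sq, sum_inner]
    refine Finset.sum_congr rfl fun j hj => ?_
    rw [real_inner_smul_left, he.inner_sum_smul s hj]
    ring
  rw [norm_sub_sq_real, h1, h2]
  ring

theorem sum_inner_sq_le (he : IsWeightedOrthonormal a e) (s : Finset ι) (v : H) :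
    ∑ j ∈ s, ⟪e j, v⟫_ℝ ^ 2 ≤ ‖v‖ ^ 2 := by
  have := he.norm_sub_sum_sq s v
  nlinarith [sq_nonneg ‖v - ∑ j ∈ s, ⟪e j, v⟫_ℝ • e j‖]

end IsWeightedOrthonormal

theorem inner_sum_smul_tmul_self {ι κ : Type*} (s : Finset ι) (t : Finset κ) (a : ι → ℝ)
    (b : κ → ℝ) (e : ι → H) (f : κ → H) :
    ⟪∑ i ∈ s, a i • (e i ⊗ₜ[ℝ] e i), ∑ j ∈ t, b j • (f j ⊗ₜ[ℝ] f j)⟫_ℝ =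
      ∑ i ∈ s, ∑ j ∈ t, a i * b j * ⟪e i, f j⟫_ℝ ^ 2 := by
  rw [sum_inner]
  refine Finset.sum_congr rfl fun i _ => ?_
  rw [inner_sum]
  refine Finset.sum_congr rfl fun j _ => ?_
  rw [TensorProduct.smul_tmul', TensorProduct.smul_tmul', TensorProduct.inner_tmul,
    real_inner_smul_left, real_inner_smul_right]
  ring

theorem IsWeightedOrthonormal.norm_sum_smul_tmul_self_sq {ι : Type*} {a : ι → ℝ} {e : ι → H}
    (he : IsWeightedOrthonormal a e) (s : Finset ι) :
    ‖∑ i ∈ s, a i • (e i ⊗ₜ[ℝ] e i)‖ ^ 2 = ∑ i ∈ s, a i ^ 2 := by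
  rw [← real_inner_self_eq_norm_sq, inner_sum_smul_tmul_self]
  refine Finset.sum_congr rfl fun i hi => ?_
  rw [Finset.sum_eq_single_of_mem i hi fun j _ hj => ?_, real_inner_self_eq_norm_sq]
  · have := he.weight_mul_norm_sq i
    calc a i * a i * (‖e i‖ ^ 2) ^ 2 = (a i * ‖e i‖ ^ 2) * (a i * ‖e i‖ ^ 2) := by ring
      _ = a i ^ 2 := by rw [this]; ring
  · rw [he.1 _ _ hj.symm]
    ring

/-- The **Hoffman–Wielandt inequality** for two positive semidefinite finite-rank operators given
by spectral decompositions; the squared Hilbert–Schmidt distance on the right is written out. -/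
theorem sum_sub_sq_le_of_isWeightedOrthonormal {N k : ℕ} (hkN : k ≤ N) {a : Fin N → ℝ}
    {g : Fin k → ℝ} (ha : Antitone a) (ha0 : ∀ i, 0 ≤ a i) (hg : Antitone g) (hg0 : ∀ j, 0 ≤ g j)
    {e : Fin N → H} {f : Fin k → H} (he : IsWeightedOrthonormal a e)
    (hf : IsWeightedOrthonormal g f) :
    ∑ j, (a (Fin.castLE hkN j) - g j) ^ 2 ≤
      ∑ i, a i ^ 2 + ∑ j, g j ^ 2 - 2 * ∑ i, ∑ j, a i * g j * ⟪e i, f j⟫_ℝ ^ 2 := by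
  have h1 := sum_mul_mul_substochastic_le hkN ha ha0 hg hg0 (S := fun i j => ⟪e i, f j⟫_ℝ ^ 2)
    (fun _ _ => sq_nonneg _)
    (fun i => by
      simp_rw [fun j => real_inner_comm (f j) (e i)]
      refine (hf.sum_inner_sq_le Finset.univ (e i)).trans ?_
      have := he.norm_le_one i
      nlinarith [norm_nonneg (e i)])
    (fun j => by
      refine (he.sum_inner_sq_le Finset.univ (f j)).trans ?_
      have := hf.norm_le_one j
      nlinarith [norm_nonneg (f j)])
  have h2 : ∑ j, a (Fin.castLE hkN j) ^ 2 ≤ ∑ i, a i ^ 2 := by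
    have := Finset.sum_le_sum_of_subset_of_nonneg
      (Finset.subset_univ (Finset.univ.map (Fin.castLEEmb hkN)))
      (f := fun i => a i ^ 2) fun i _ _ => sq_nonneg (a i)
    simpa using this
  have h3 : ∑ j, (a (Fin.castLE hkN j) - g j) ^ 2 =
      ∑ j, a (Fin.castLE hkN j) ^ 2 + ∑ j, g j ^ 2 - 2 * ∑ j, a (Fin.castLE hkN j) * g j := by
    rw [Finset.mul_sum, ← Finset.sum_add_distrib, ← Finset.sum_sub_distrib]
    exact Finset.sum_congr rfl fun j _ => by ring
  rw [h3]
  linarith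
end

/-! ### Weighted Gram matrices -/

section
variable {H : Type*} [NormedAddCommGroup H] [InnerProductSpace ℝ H]

/-- The positive operator `∑ c j φ j φ jᵀ` has a spectral decomposition whose eigenvalues `g` are
close to `c` when the unit vectors `φ j` are almost orthogonal: its nonzero spectrum is that of the
weighted Gram matrix `(√(c i c j) ⟪φ i, φ j⟫)`, whose off-diagonal part is the right-hand side. -/
theorem exists_spectral_decomposition_sum_smul_tmul_self [CompleteSpace H] {k : ℕ} {c : Fin k → ℝ}
    (hc : Antitone c) (hc0 : ∀ i, 0 ≤ c i) {φ : Fin k → H} (hφ : ∀ i, ‖φ i‖ = 1) :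
    ∃ (g : Fin k → ℝ) (u : Fin k → H), Antitone g ∧ (∀ i, 0 ≤ g i) ∧ IsWeightedOrthonormal g u ∧
      ∑ j, c j • (φ j ⊗ₜ[ℝ] φ j) = ∑ j, g j • (u j ⊗ₜ[ℝ] u j) ∧
      ∑ j, (g j - c j) ^ 2 ≤
        ∑ i, ∑ j, (if i = j then 0 else c i * c j * ⟪φ i, φ j⟫_ℝ ^ 2) := by
  set ε := EuclideanSpace.basisFun (Fin k) ℝ
  -- `A` maps the standard basis vectors to the weighted vectors, so that `A Aᵀ` is the given
  -- operator and `Aᵀ A` the Gram matrix.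
  set A : EuclideanSpace ℝ (Fin k) →L[ℝ] H :=
    LinearMap.toContinuousLinearMap (ε.toBasis.constr ℝ fun j => √(c j) • φ j) with hA
  have hAε : ∀ j, A (ε j) = √(c j) • φ j := by
    intro j
    simp [hA]
  set T : EuclideanSpace ℝ (Fin k) →ₗ[ℝ] EuclideanSpace ℝ (Fin k) :=
    (A.adjoint ∘L A).toLinearMap with hTdef
  have hTin : ∀ v w, ⟪v, T w⟫_ℝ = ⟪A v, A w⟫_ℝ := by
    intro v w
    simp [hTdef, ContinuousLinearMap.adjoint_inner_right]
  have hT : T.IsSymmetric := by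
    intro v w
    rw [real_inner_comm, hTin, hTin, real_inner_comm]
  have hfin : Module.finrank ℝ (EuclideanSpace ℝ (Fin k)) = k := by simp
  set g := hT.eigenvalues hfin with hg
  set w := hT.eigenvectorBasis hfin with hw
  have hTw : ∀ i, T (w i) = g i • w i := fun i => hT.apply_eigenvectorBasis hfin i
  have hAw : ∀ i j, ⟪A (w i), A (w j)⟫_ℝ = if i = j then g j else 0 := by
    intro i j
    rw [← hTin, hTw, real_inner_smul_right, orthonormal_iff_ite.1 w.orthonormal]
    simp
  have hg0 : ∀ i, 0 ≤ g i := by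
    intro i
    have := hAw i i
    rw [if_pos rfl] at this
    rw [← this]
    exact real_inner_self_nonneg
  have hganti : Antitone g := hT.eigenvalues_antitone hfin
  set u : Fin k → H := fun i => (√(g i))⁻¹ • A (w i) with hu
  have hgu : ∀ i, g i • (u i ⊗ₜ[ℝ] u i) = A (w i) ⊗ₜ[ℝ] A (w i) := by
    intro i
    rcases (hg0 i).eq_or_lt with h | h
    · have : A (w i) = 0 := by
        have := hAw i i
        rwa [if_pos rfl, ← h, inner_self_eq_zero] at this
      simp [hu, this]
    · simp only [hu]
      rw [TensorProduct.smul_tmul_smul, smul_smul, ← mul_inv, Real.mul_self_sqrt h.le,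
        mul_inv_cancel₀ h.ne', one_smul]
  have huo : IsWeightedOrthonormal g u := by
    refine ⟨fun i j hij => ?_, fun i => ?_⟩
    · simp only [hu]
      rw [real_inner_smul_left, real_inner_smul_right, hAw, if_neg hij]
      simp
    · rcases (hg0 i).eq_or_lt with h | h
      · exact Or.inr ⟨h.symm, by simp [hu, ← h]⟩
      · left
        have h1 : ‖A (w i)‖ = √(g i) := by
          rw [norm_eq_sqrt_real_inner, hAw, if_pos rfl]
        simp only [hu]
        rw [norm_smul, h1, norm_inv, Real.norm_of_nonneg (Real.sqrt_nonneg _),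
          inv_mul_cancel₀ (Real.sqrt_pos.2 h).ne']
  have hsum : ∑ j, c j • (φ j ⊗ₜ[ℝ] φ j) = ∑ j, g j • (u j ⊗ₜ[ℝ] u j) := by
    have h1 := (InnerProductSpace.canonicalCovariantTensor_eq_sum _ w).symm.trans
      (InnerProductSpace.canonicalCovariantTensor_eq_sum _ ε)
    have h2 := congrArg (TensorProduct.map (A : _ →ₗ[ℝ] H) (A : _ →ₗ[ℝ] H)) h1
    simp only [map_sum, TensorProduct.map_tmul, ContinuousLinearMap.coe_coe] at h2
    simp_rw [hgu, h2, hAε]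
    refine Finset.sum_congr rfl fun j _ => ?_
    rw [TensorProduct.smul_tmul_smul, Real.mul_self_sqrt (hc0 j)]
  refine ⟨g, u, hganti, hg0, huo, hsum, ?_⟩
  have hHW := sum_sub_sq_le_of_isWeightedOrthonormal le_rfl hganti hg0 hc hc0
    (w.orthonormal.isWeightedOrthonormal g) (ε.orthonormal.isWeightedOrthonormal c)
  have hdiag : ∑ i, ∑ j, g i * c j * ⟪w i, ε j⟫_ℝ ^ 2 = ∑ j, c j ^ 2 := by
    rw [Finset.sum_comm]
    refine Finset.sum_congr rfl fun j _ => ?_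
    have h1 : ∑ i, g i * ⟪w i, ε j⟫_ℝ ^ 2 = c j := by
      have h2 : ⟪ε j, T (ε j)⟫_ℝ = c j := by
        rw [hTin, hAε, real_inner_smul_left, real_inner_smul_right, real_inner_self_eq_norm_sq,
          hφ, ← mul_assoc, Real.mul_self_sqrt (hc0 j)]
        ring
      rw [← h2, ← w.sum_inner_mul_inner]
      refine Finset.sum_congr rfl fun i _ => ?_
      rw [← hT, hTw, real_inner_smul_left, real_inner_comm]
      ring
    calc ∑ i, g i * c j * ⟪w i, ε j⟫_ℝ ^ 2 = c j * ∑ i, g i * ⟪w i, ε j⟫_ℝ ^ 2 := by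
          rw [Finset.mul_sum]
          exact Finset.sum_congr rfl fun i _ => by ring
      _ = c j ^ 2 := by rw [h1]; ring
  have hnorm : ∑ i, g i ^ 2 = ∑ i, ∑ j, c i * c j * ⟪φ i, φ j⟫_ℝ ^ 2 := by
    rw [← huo.norm_sum_smul_tmul_self_sq, ← hsum, ← real_inner_self_eq_norm_sq,
      inner_sum_smul_tmul_self]
  have hsplit : ∑ i, ∑ j, c i * c j * ⟪φ i, φ j⟫_ℝ ^ 2 =
      ∑ i, ∑ j, (if i = j then 0 else c i * c j * ⟪φ i, φ j⟫_ℝ ^ 2) + ∑ i, c i ^ 2 := by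
    rw [← Finset.sum_add_distrib]
    refine Finset.sum_congr rfl fun i _ => ?_
    have : ∀ j, c i * c j * ⟪φ i, φ j⟫_ℝ ^ 2 =
        (if i = j then 0 else c i * c j * ⟪φ i, φ j⟫_ℝ ^ 2) + if i = j then c i ^ 2 else 0 := by
      intro j
      split_ifs with h
      · subst h
        rw [real_inner_self_eq_norm_sq, hφ]
        ring
      · simp
    rw [Finset.sum_congr rfl fun j _ => this j, Finset.sum_add_distrib]
    simp
  rw [hdiag, hnorm, hsplit] at hHW
  simp only [Fin.castLE_rfl, id_eq] at hHW
  linarith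
end

/-! ### Sorting a discrete family of positive numbers -/

/-- A family of positive numbers of which only finitely many exceed any given `t > 0` can be
listed in descending order, padded by zeros. -/
theorem exists_antitone_encard_eq {S : Type*} {w : S → ℝ}
    (hfin : ∀ t : ℝ, 0 < t → {s | t ≤ w s}.Finite) :
    ∃ lam : ℕ → ℝ, Antitone lam ∧ (∀ n, 0 ≤ lam n) ∧
      ∀ t : ℝ, 0 < t → {n | lam n = t}.encard = {s | w s = t}.encard := by
  set D : ℝ → ℕ := fun t => {s | t ≤ w s}.ncard with hD
  have hDanti : ∀ t t' : ℝ, 0 < t → t ≤ t' → D t' ≤ D t := fun t t' ht htt' =>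
    Set.ncard_le_ncard (fun s hs => htt'.trans hs) (hfin t ht)
  -- The `n`-th value is the largest `t` with more than `n` members at or above `t`; where there is
  -- no such `t` the supremum of the empty set gives the padding zero.
  set lam : ℕ → ℝ := fun n => sSup {t | 0 < t ∧ n < D t} with hlam
  have hbdd : ∀ n, BddAbove {t | 0 < t ∧ n < D t} := by
    intro n
    obtain ⟨B, hB⟩ := ((hfin 1 one_pos).image w).bddAbove
    refine ⟨max 1 B, fun t ht => ?_⟩
    by_contra! hlt
    have hne : {s | t ≤ w s}.Nonempty := by
      by_contra! h
      have h0 := ht.2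
      simp [hD, h] at h0
    obtain ⟨s, hs⟩ := hne
    have h1 : t ≤ w s := hs
    have h2 := hB ⟨s, (le_max_left 1 B).trans (hlt.le.trans h1), rfl⟩
    have h3 := le_max_right 1 B
    linarith
  have hnonneg : ∀ n, 0 ≤ lam n := fun n => Real.sSup_nonneg fun t ht => ht.1.le
  have hle : ∀ t : ℝ, 0 < t → ∀ n, t ≤ lam n ↔ n < D t := by
    intro t ht n
    refine ⟨fun h => ?_, fun h => le_csSup (hbdd n) ⟨ht, h⟩⟩
    by_contra! hn
    -- Just below `t` the counting function has the same value as at `t`.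
    have h1 : ∀ᶠ t' in nhdsWithin t (Set.Iio t), ∀ s ∈ {s | t / 2 ≤ w s}, t' ≤ w s → t ≤ w s := by
      rw [(hfin (t / 2) (half_pos ht)).eventually_all]
      intro s _
      rcases le_or_gt t (w s) with hs | hs
      · exact Filter.Eventually.of_forall fun _ _ => hs
      · filter_upwards [Ioo_mem_nhdsLT hs] with t' ht' h
        exact absurd h (not_le.2 ht'.1)
    obtain ⟨t', h2, h3, h4⟩ := (h1.and (Ioo_mem_nhdsLT (half_lt_self ht))).exists
    have ht' : 0 < t' := (half_pos ht).trans h3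
    have h5 : D t' = D t := by
      have : {s | t' ≤ w s} = {s | t ≤ w s} :=
        Set.ext fun s => ⟨fun hs => h2 s (h3.le.trans hs) hs, fun hs => h4.le.trans hs⟩
      simp only [hD, this]
    refine absurd (h.trans (Real.sSup_le (fun r hr => ?_) ht'.le)) (not_le.2 h4)
    by_contra! hr'
    have := hDanti t' r ht' hr'.le
    have := hr.2
    omega
  refine ⟨lam, fun m n hmn => ?_, hnonneg, fun t ht => ?_⟩
  · rcases (hnonneg n).eq_or_lt with h | h
    · rw [← h]
      exact hnonneg m
    · rw [hle _ h]
      exact hmn.trans_lt ((hle _ h n).1 le_rfl)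
  · set D' : ℕ := {s | t < w s}.ncard with hD'
    have hfin' : {s | t < w s}.Finite := (hfin t ht).subset fun s (hs : t < w s) => hs.le
    have hlt : ∀ n, t < lam n ↔ n < D' := by
      intro n
      constructor
      · intro h
        have h1 := (hle _ (ht.trans h) n).1 le_rfl
        exact h1.trans_le (Set.ncard_le_ncard (fun s hs => h.trans_le hs) hfin')
      · intro h
        have h1 : ∀ᶠ t' in nhdsWithin t (Set.Ioi t), ∀ s ∈ {s | t < w s}, t' ≤ w s := by
          rw [hfin'.eventually_all]
          intro s hs
          filter_upwards [Ioo_mem_nhdsGT hs] with t' ht'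
          exact ht'.2.le
        obtain ⟨t', h2, h3⟩ := (h1.and self_mem_nhdsWithin).exists
        have h3' : t < t' := h3
        refine h3'.trans_le ((hle _ (ht.trans h3') n).2 (h.trans_le ?_))
        exact Set.ncard_le_ncard h2 (hfin _ (ht.trans h3'))
    have hset : {n | lam n = t} = Set.Ico D' (D t) := by
      ext n
      have h1 := hle t ht n
      have h2 := hlt n
      simp only [Set.mem_ofPred_eq, Set.mem_Ico]
      constructor
      · rintro h
        exact ⟨not_lt.1 fun h' => (h2.2 h').ne' h, h1.1 h.ge⟩
      · rintro ⟨h3, h4⟩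
        exact le_antisymm (not_lt.1 fun h' => not_lt.2 h3 (h2.1 h')) (h1.2 h4)
    have heq : (D t : ℕ) = {s | w s = t}.ncard + D' := by
      rw [hD', ← Set.ncard_union_eq _ ((hfin t ht).subset fun s hs => hs.ge) hfin']
      · refine congrArg Set.ncard (Set.ext fun s => ?_)
        change t ≤ w s ↔ w s = t ∨ t < w s
        rw [le_iff_eq_or_lt, eq_comm]
      · exact Set.disjoint_left.2 fun s hs hs' => (ne_of_gt hs') hs
    have hfin'' : {s | w s = t}.Finite := (hfin t ht).subset fun s hs => hs.ge
    rw [hset, ← hfin''.cast_ncard_eq, Set.encard_eq_coe_toFinset_card]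
    simp [heq]

/-! ### Positive eigenvalues of a compact symmetric operator -/

section
variable {H : Type*} [NormedAddCommGroup H] [InnerProductSpace ℝ H]

/-- A bound on the trace of `T` over finite orthonormal families leaves room for only finitely many
orthonormal eigenvectors with eigenvalue at least `t > 0`. -/
theorem finite_setOf_le_eigenvalue {T : H →L[ℝ] H} {C : ℝ}
    (htr : ∀ (n : ℕ) (e : Fin n → H), Orthonormal ℝ e → ∑ i, ⟪e i, T (e i)⟫_ℝ ≤ C)
    {S : Type*} {v : S → H} (hv : Orthonormal ℝ v) {w : S → ℝ} (hw : ∀ s, T (v s) = w s • v s)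
    {t : ℝ} (ht : 0 < t) : {s | t ≤ w s}.Finite := by
  by_contra hinf
  obtain ⟨n, hn⟩ := exists_nat_gt (C / t)
  obtain ⟨F, hF, hcard⟩ := (show {s | t ≤ w s}.Infinite from hinf).exists_subset_card_eq n
  have h1 := htr _ (fun i => v (F.equivFin.symm i))
    (hv.comp _ (Subtype.val_injective.comp F.equivFin.symm.injective))
  have h2 : (n : ℝ) * t ≤
      ∑ i, ⟪v (F.equivFin.symm i), T (v (F.equivFin.symm i))⟫_ℝ := by
    have : ∀ i : Fin F.card, t ≤ ⟪v (F.equivFin.symm i), T (v (F.equivFin.symm i))⟫_ℝ := by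
      intro i
      rw [hw, real_inner_smul_right, real_inner_self_eq_norm_sq, hv.1]
      have : t ≤ w (F.equivFin.symm i) := hF (F.equivFin.symm i).2
      linarith
    calc (n : ℝ) * t = ∑ _i : Fin F.card, t := by simp [hcard]
      _ ≤ _ := Finset.sum_le_sum fun i _ => this i
  rw [div_lt_iff₀ ht] at hn
  linarith

theorem toENat_rank_eq_finrank (V : Submodule ℝ H) [FiniteDimensional ℝ V] :
    Cardinal.toENat (Module.rank ℝ V) = Module.finrank ℝ V := by
  rw [← Module.finrank_eq_rank, Cardinal.toENat_nat]

/-- The positive eigenvalues of an operator with bounded trace tend to zero. -/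
theorem IsWeightedOrthonormal.exists_forall_ge_lt {T : H →L[ℝ] H} {C : ℝ}
    (htr : ∀ (n : ℕ) (e : Fin n → H), Orthonormal ℝ e → ∑ i, ⟪e i, T (e i)⟫_ℝ ≤ C)
    {lam : ℕ → ℝ} {e : ℕ → H} (he : IsWeightedOrthonormal lam e)
    (heig : ∀ n, T (e n) = lam n • e n) {ε : ℝ} (hε : 0 < ε) :
    ∃ N, ∀ n ≥ N, lam n < ε := by
  have h1 : Orthonormal ℝ fun n : {n // ε ≤ lam n} => e n := by
    refine ⟨fun n => (he.2 n).resolve_right fun h => ?_, fun n m hnm => ?_⟩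
    · linarith [n.2, h.1]
    · exact he.1 _ _ fun h => hnm (Subtype.ext h)
  have h2 := finite_setOf_le_eigenvalue htr h1 (w := fun n => lam n) (fun n => heig n) hε
  have h3 : {n | ε ≤ lam n}.Finite := by
    refine (h2.image Subtype.val).subset fun n hn => ⟨⟨n, hn⟩, hn, rfl⟩
  obtain ⟨B, hB⟩ := h3.bddAbove
  refine ⟨B + 1, fun n hn => ?_⟩
  by_contra! h
  have := hB h
  omega
variable [CompleteSpace H]

theorem exists_isPosEigenvalueSeq {T : H →L[ℝ] H} (hT : IsCompactOperator T)
    (hsymm : (T : H →ₗ[ℝ] H).IsSymmetric) {C : ℝ}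
    (htr : ∀ (n : ℕ) (e : Fin n → H), Orthonormal ℝ e → ∑ i, ⟪e i, T (e i)⟫_ℝ ≤ C) :
    ∃ lam : ℕ → ℝ, IsPosEigenvalueSeq T lam := by
  have hfd : ∀ t : {t : ℝ // 0 < t},
      FiniteDimensional ℝ (Module.End.eigenspace (T : H →ₗ[ℝ] H) t.1) := fun t =>
    ContinuousLinearMap.finite_dimensional_eigenspace hT t.1 t.2.ne'
  let b := fun t : {t : ℝ // 0 < t} =>
    stdOrthonormalBasis ℝ (Module.End.eigenspace (T : H →ₗ[ℝ] H) t.1)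
  have hortho := (hsymm.orthogonalFamily_eigenspaces.comp
    (Subtype.val_injective (p := fun t : ℝ => 0 < t))).orthonormal_sigma_orthonormal
    (fun t => (b t).orthonormal)
  obtain ⟨lam, h1, h2, h3⟩ := exists_antitone_encard_eq (w := fun s : (Σ t : {t : ℝ // 0 < t},
    Fin (Module.finrank ℝ (Module.End.eigenspace (T : H →ₗ[ℝ] H) t.1))) => s.1.1)
    (fun t ht => finite_setOf_le_eigenvalue htr hortho
      (fun s => Module.End.mem_eigenspace_iff.1 (b s.1 s.2).2) ht)
  refine ⟨lam, h1, h2, fun t ht => ?_⟩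
  have := hfd ⟨t, ht⟩
  rw [h3 t ht, toENat_rank_eq_finrank]
  have himage : {s : (Σ t : {t : ℝ // 0 < t},
      Fin (Module.finrank ℝ (Module.End.eigenspace (T : H →ₗ[ℝ] H) t.1))) | s.1.1 = t} =
      Sigma.mk (⟨t, ht⟩ : {t : ℝ // 0 < t}) '' Set.univ := by
    ext ⟨⟨t', ht'⟩, i⟩
    constructor
    · rintro h
      obtain rfl : t' = t := h
      exact ⟨i, trivial, rfl⟩
    · rintro ⟨j, -, hj⟩
      exact congrArg (fun s => s.1.1) hj.symm
  rw [himage, sigma_mk_injective.encard_image]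
  simp

/-- Orthonormal eigenvectors matching a list of positive eigenvalues; the padding zeros get the
zero vector. -/
theorem IsPosEigenvalueSeq.exists_eigenvectors {T : H →L[ℝ] H} {lam : ℕ → ℝ}
    (hlam : IsPosEigenvalueSeq T lam) (hT : IsCompactOperator T)
    (hsymm : (T : H →ₗ[ℝ] H).IsSymmetric) :
    ∃ e : ℕ → H, IsWeightedOrthonormal lam e ∧ (∀ n, T (e n) = lam n • e n) ∧
      ∀ t : ℝ, 0 < t → Module.End.eigenspace (T : H →ₗ[ℝ] H) t ≤
        Submodule.span ℝ (e '' {n | lam n = t}) := by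
  have key : ∀ t : ℝ, 0 < t → ∃ f : ℕ → H,
      (∀ n, lam n = t → f n ∈ Module.End.eigenspace (T : H →ₗ[ℝ] H) t ∧ ‖f n‖ = 1) ∧
      (∀ n m, lam n = t → lam m = t → n ≠ m → ⟪f n, f m⟫_ℝ = 0) ∧
      Module.End.eigenspace (T : H →ₗ[ℝ] H) t ≤ Submodule.span ℝ (f '' {n | lam n = t}) := by
    intro t ht
    have hfd : FiniteDimensional ℝ (Module.End.eigenspace (T : H →ₗ[ℝ] H) t) :=
      ContinuousLinearMap.finite_dimensional_eigenspace hT t ht.ne'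
    set d := Module.finrank ℝ (Module.End.eigenspace (T : H →ₗ[ℝ] H) t) with hd
    have hcard : {n | lam n = t}.encard = d := by
      rw [hlam.2.2 t ht, toENat_rank_eq_finrank]
    have hfin : {n | lam n = t}.Finite := Set.finite_of_encard_eq_coe hcard
    have hncard : Nat.card {n | lam n = t} = d := by
      rw [Nat.card_coe_set_eq, Set.ncard, hcard, ENat.toNat_natCast]
    have := hfin.to_subtype
    let eqv : {n | lam n = t} ≃ Fin d := Finite.equivFinOfCardEq hncard
    let b := stdOrthonormalBasis ℝ (Module.End.eigenspace (T : H →ₗ[ℝ] H) t)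
    classical
    let f : ℕ → H := fun n => if h : lam n = t then (b (eqv ⟨n, h⟩) : H) else 0
    have hf : ∀ n (h : lam n = t), f n = (b (eqv ⟨n, h⟩) : H) := fun n h => dif_pos h
    refine ⟨f, fun n h => ?_, fun n m hn hm hnm => ?_, fun v hv => ?_⟩
    · rw [hf n h]
      exact ⟨(b _).2, b.orthonormal.1 _⟩
    · rw [hf n hn, hf m hm]
      exact b.orthonormal.2 (eqv.injective.ne fun h => hnm (congrArg Subtype.val h))
    · have h1 := congrArg Subtype.val (b.sum_repr ⟨v, hv⟩)
      rw [AddSubmonoidClass.coe_finsetSum] at h1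
      change _ = v at h1
      rw [← h1]
      refine Submodule.sum_mem _ fun i _ => Submodule.smul_mem _ _ (Submodule.subset_span ?_)
      have h2 : lam (eqv.symm i) = t := (eqv.symm i).2
      exact ⟨eqv.symm i, h2, by rw [hf _ h2]; simp⟩
  choose f hf1 hf2 hf3 using key
  set e : ℕ → H := fun n => if h : 0 < lam n then f (lam n) h n else 0 with he
  have he1 : ∀ n (t : ℝ) (ht : 0 < t), lam n = t → e n = f t ht n := by
    rintro n t ht rfl
    exact dif_pos ht
  have he0 : ∀ n, lam n = 0 → e n = 0 := fun n hn => dif_neg (by simp [hn])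
  have heig : ∀ n, T (e n) = lam n • e n := by
    intro n
    rcases (hlam.2.1 n).eq_or_lt with h | h
    · simp [he0 n h.symm]
    · rw [he1 n _ h rfl]
      exact Module.End.mem_eigenspace_iff.1 (hf1 _ h n rfl).1
  refine ⟨e, ⟨fun n m hnm => ?_, fun n => ?_⟩, heig, fun t ht => ?_⟩
  · by_cases hl : lam n = lam m
    · rcases (hlam.2.1 n).eq_or_lt with h | h
      · simp [he0 n h.symm]
      · rw [he1 n _ h rfl, he1 m _ h hl.symm]
        exact hf2 _ h n m rfl hl.symm hnm
    · have h1 : ⟪T (e n), e m⟫_ℝ = ⟪e n, T (e m)⟫_ℝ := hsymm _ _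
      rw [heig, heig, real_inner_smul_left, real_inner_smul_right] at h1
      have h2 : (lam n - lam m) * ⟪e n, e m⟫_ℝ = 0 := by linarith
      exact (mul_eq_zero.1 h2).resolve_left (sub_ne_zero.2 hl)
  · rcases (hlam.2.1 n).eq_or_lt with h | h
    · exact Or.inr ⟨h.symm, he0 n h.symm⟩
    · left
      rw [he1 n _ h rfl]
      exact (hf1 _ h n rfl).2
  · have : e '' {n | lam n = t} = f t ht '' {n | lam n = t} :=
      Set.image_congr fun n hn => he1 n t ht hn
    rw [this]
    exact hf3 t ht

/-- A vector orthogonal to all eigenspaces of a compact symmetric operator with eigenvalue above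
`ε` lies in the closed span of the others, where the quadratic form is at most `ε ‖·‖²`. -/
theorem inner_apply_le_of_orthogonal_eigenspaces {T : H →L[ℝ] H} (hT : IsCompactOperator T)
    (hsymm : (T : H →ₗ[ℝ] H).IsSymmetric) {ε : ℝ} {u : H}
    (hu : ∀ t : ℝ, ε < t → u ∈ (Module.End.eigenspace (T : H →ₗ[ℝ] H) t)ᗮ) :
    ⟪u, T u⟫_ℝ ≤ ε * ‖u‖ ^ 2 := by
  set E := fun t : ℝ => Module.End.eigenspace (T : H →ₗ[ℝ] H) t with hE
  have hOF := hsymm.orthogonalFamily_eigenspaces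
  set K : Submodule ℝ H := ⨆ t : {t : ℝ // t ≤ ε}, E t.1 with hK
  have hclosed : IsClosed {v : H | ⟪v, T v⟫_ℝ ≤ ε * ‖v‖ ^ 2} :=
    isClosed_le (by fun_prop) (by fun_prop)
  have hKle : ∀ v ∈ K, ⟪v, T v⟫_ℝ ≤ ε * ‖v‖ ^ 2 := by
    intro v hv
    obtain ⟨c, hc, rfl⟩ := (Submodule.mem_iSup_iff_exists_finsupp _ _).1 hv
    rw [Finsupp.sum]
    have hOF' := hOF.comp (Subtype.val_injective (p := fun t : ℝ => t ≤ ε))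
    let l : (t : {t : ℝ // t ≤ ε}) → E t.1 := fun t => ⟨c t, hc t⟩
    have h1 : T (∑ i ∈ c.support, c i) = ∑ i ∈ c.support, ((i.1 • l i : E i.1) : H) := by
      rw [map_sum]
      exact Finset.sum_congr rfl fun t _ => Module.End.mem_eigenspace_iff.1 (hc t)
    have h2 := hOF'.inner_sum l (fun t => t.1 • l t) c.support
    have h3 := hOF'.norm_sum l c.support
    change ⟪∑ i ∈ c.support, c i, ∑ i ∈ c.support, ((i.1 • l i : E i.1) : H)⟫_ℝ = _ at h2
    change ‖∑ i ∈ c.support, c i‖ ^ 2 = _ at h3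
    rw [h1, h2, h3, Finset.mul_sum]
    refine Finset.sum_le_sum fun t _ => ?_
    rw [real_inner_smul_right, real_inner_self_eq_norm_sq]
    exact mul_le_mul_of_nonneg_right t.2 (sq_nonneg _)
  have hcl : ∀ v ∈ K.topologicalClosure, ⟪v, T v⟫_ℝ ≤ ε * ‖v‖ ^ 2 := fun v hv =>
    closure_minimal hKle hclosed hv
  have : CompleteSpace K.topologicalClosure := K.isClosed_topologicalClosure.completeSpace_coe
  obtain ⟨y, hy, z, hz, hyz⟩ := Submodule.exists_add_mem_mem_orthogonal
    (K := K.topologicalClosure) u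
  have hz0 : z = 0 := by
    have hbot := ContinuousLinearMap.orthogonalComplement_iSup_eigenspaces_eq_bot hT hsymm
    rw [← Submodule.mem_bot ℝ, ← hbot, ← Submodule.iInf_orthogonal, Submodule.mem_iInf]
    intro t
    rcases le_or_gt t ε with ht | ht
    · exact Submodule.orthogonal_le ((le_iSup (fun t : {t : ℝ // t ≤ ε} => E t.1) ⟨t, ht⟩).trans
        K.le_topologicalClosure) hz
    · have hKt : K ≤ (E t)ᗮ := by
        refine iSup_le fun s => ?_
        exact (hOF.isOrtho (fun h => (s.2.trans_lt ht).ne h) : E s.1 ⟂ E t)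
      have hy' : y ∈ (E t)ᗮ :=
        K.topologicalClosure_minimal hKt (Submodule.isClosed_orthogonal _) hy
      have : z = u - y := by rw [hyz]; abel
      rw [this]
      exact Submodule.sub_mem _ (hu t ht) hy'
  rw [hyz, hz0, add_zero]
  exact hcl y hy

theorem IsWeightedOrthonormal.inner_apply_le {T : H →L[ℝ] H} {lam : ℕ → ℝ} {e : ℕ → H}
    (he : IsWeightedOrthonormal lam e) (hanti : Antitone lam) (hT : IsCompactOperator T)
    (hsymm : (T : H →ₗ[ℝ] H).IsSymmetric) (heig : ∀ n, T (e n) = lam n • e n)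
    (hspan : ∀ t : ℝ, 0 < t → Module.End.eigenspace (T : H →ₗ[ℝ] H) t ≤
        Submodule.span ℝ (e '' {n | lam n = t}))
    {ε : ℝ} (hε : 0 < ε) {N : ℕ} (hN : lam N ≤ ε) (v : H) :
    ⟪v, T v⟫_ℝ ≤ ∑ i ∈ Finset.range N, lam i * ⟪e i, v⟫_ℝ ^ 2 + ε * ‖v‖ ^ 2 := by
  set w := ∑ i ∈ Finset.range N, ⟪e i, v⟫_ℝ • e i with hw
  set u := v - w with hu
  have hue : ∀ i ∈ Finset.range N, ⟪e i, u⟫_ℝ = 0 := fun i hi => by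
    rw [hu, inner_sub_right, hw, he.inner_sum_smul _ hi, sub_self]
  have hTw : T w = ∑ i ∈ Finset.range N, (⟪e i, v⟫_ℝ * lam i) • e i := by
    rw [hw, map_sum]
    exact Finset.sum_congr rfl fun i _ => by rw [map_smul, heig, smul_smul]
  have huTw : ⟪u, T w⟫_ℝ = 0 := by
    rw [hTw, inner_sum]
    refine Finset.sum_eq_zero fun i hi => ?_
    rw [real_inner_smul_right, real_inner_comm (e i) u, hue i hi, mul_zero]
  have hwTu : ⟪w, T u⟫_ℝ = 0 := by
    rw [← huTw, real_inner_comm]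
    exact hsymm u w
  have hwTw : ⟪v, T w⟫_ℝ = ∑ i ∈ Finset.range N, lam i * ⟪e i, v⟫_ℝ ^ 2 := by
    rw [hTw, inner_sum]
    refine Finset.sum_congr rfl fun i _ => ?_
    rw [real_inner_smul_right, real_inner_comm]
    ring
  have huTu : ⟪u, T u⟫_ℝ ≤ ε * ‖u‖ ^ 2 := by
    refine inner_apply_le_of_orthogonal_eigenspaces hT hsymm fun t ht => ?_
    refine Submodule.orthogonal_le (hspan t (hε.trans ht)) ?_
    rw [Submodule.mem_orthogonal]
    intro x hx
    induction hx using Submodule.span_induction with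
    | mem x hx =>
      obtain ⟨n, hn, rfl⟩ := hx
      refine hue n (Finset.mem_range.2 ?_)
      by_contra! h
      have h1 : lam n = t := hn
      linarith [hanti h]
    | zero => simp
    | add x y _ _ hx hy => rw [inner_add_left, hx, hy, add_zero]
    | smul c x _ hx => rw [real_inner_smul_left, hx, mul_zero]
  have hnorm : ‖u‖ ^ 2 ≤ ‖v‖ ^ 2 := by
    rw [hu, hw, he.norm_sub_sum_sq]
    linarith [Finset.sum_nonneg fun (i : ℕ) (_ : i ∈ Finset.range N) => sq_nonneg ⟪e i, v⟫_ℝ]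
  have hsplit : ⟪v, T v⟫_ℝ = ⟪v, T w⟫_ℝ + ⟪u, T u⟫_ℝ := by
    have hv : v = w + u := by rw [hu]; abel
    have h1 : ⟪v, T u⟫_ℝ = ⟪w, T u⟫_ℝ + ⟪u, T u⟫_ℝ := by
      rw [← inner_add_left, ← hv]
    have h2 : T v = T w + T u := by rw [← map_add, ← hv]
    rw [h2, inner_add_right, h1, hwTu, zero_add]
  rw [hsplit, hwTw]
  nlinarith
end

/-! ### Mixtures and kernel covariance operators -/

theorem isProbabilityMeasure_mixture {E : Type*} [MeasurableSpace E] {k : ℕ} {ω : Fin k → ℝ} (hω : IsProbVector ω)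
    (P : Fin k → Measure E) [∀ i, IsProbabilityMeasure (P i)] :
    IsProbabilityMeasure (mixture ω P) := by
  refine ⟨?_⟩
  simp only [mixture, Measure.coe_finsetSum, Finset.sum_apply, Measure.smul_apply, measure_univ,
    smul_eq_mul, mul_one]
  rw [← ENNReal.ofReal_sum_of_nonneg fun i _ => hω.1 i, hω.2, ENNReal.ofReal_one]

section
variable {E H : Type*} [NormedAddCommGroup H] [InnerProductSpace ℝ H] [TopologicalSpace E]
  [MeasurableSpace E] [OpensMeasurableSpace E] {φ : E → H}

theorem integrable_inner_tmul_self (hcont : Continuous φ) (hnorm : ∀ x, ‖φ x‖ = 1)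
    (P : Measure E) [IsFiniteMeasure P] (F : H ⊗[ℝ] H) :
    Integrable (fun x => ⟪F, φ x ⊗ₜ[ℝ] φ x⟫_ℝ) P := by
  have hc : Continuous fun x => ⟪F, φ x ⊗ₜ[ℝ] φ x⟫_ℝ :=
    continuous_const.inner (TensorProduct.continuous_tmul.comp (hcont.prodMk hcont))
  refine (integrable_const ‖F‖).mono' hc.aestronglyMeasurable
    (Filter.Eventually.of_forall fun x => ?_)
  have h := abs_real_inner_le_norm F (φ x ⊗ₜ[ℝ] φ x)
  rw [TensorProduct.norm_tmul, hnorm, mul_one, mul_one] at h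
  exact h

/-- Integration of the quadratic features, as a linear functional on `H ⊗ H`: it is the pairing
with the kernel covariance operator regarded as a Hilbert–Schmidt operator. -/
theorem exists_linearMap_eq_integral (hcont : Continuous φ) (hnorm : ∀ x, ‖φ x‖ = 1)
    (P : Measure E) [IsFiniteMeasure P] :
    ∃ J : H ⊗[ℝ] H →ₗ[ℝ] ℝ, ∀ F, J F = ∫ x, ⟪F, φ x ⊗ₜ[ℝ] φ x⟫_ℝ ∂P := by
  refine ⟨{ toFun := fun F => ∫ x, ⟪F, φ x ⊗ₜ[ℝ] φ x⟫_ℝ ∂P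
            map_add' := fun F G => ?_
            map_smul' := fun c F => ?_ }, fun F => rfl⟩
  · simp_rw [inner_add_left]
    exact integral_add (integrable_inner_tmul_self hcont hnorm P F)
      (integrable_inner_tmul_self hcont hnorm P G)
  · have : ∀ x, ⟪c • F, φ x ⊗ₜ[ℝ] φ x⟫_ℝ = c * ⟪F, φ x ⊗ₜ[ℝ] φ x⟫_ℝ := fun x =>
      real_inner_smul_left F _ c
    simp_rw [this, integral_const_mul]
    rfl
variable [SecondCountableTopology E]

theorem integrable_rankOne (hcont : Continuous φ) (hnorm : ∀ x, ‖φ x‖ = 1) (P : Measure E)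
    [IsFiniteMeasure P] : Integrable (fun x => InnerProductSpace.rankOne ℝ (φ x) (φ x)) P := by
  have hc : Continuous fun x => InnerProductSpace.rankOne ℝ (φ x) (φ x) := by
    exact ((InnerProductSpace.rankOne ℝ).continuous.comp hcont).clm_apply hcont
  exact (integrable_const (1 : ℝ)).mono' hc.aestronglyMeasurable
    (Filter.Eventually.of_forall fun x => by simp [hnorm])

theorem inner_kernelCovariance_apply [CompleteSpace H] (hcont : Continuous φ)
    (hnorm : ∀ x, ‖φ x‖ = 1) (P : Measure E) [IsFiniteMeasure P] (v w : H) :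
    ⟪v, kernelCovariance φ P w⟫_ℝ = ∫ x, ⟪φ x, v⟫_ℝ * ⟪φ x, w⟫_ℝ ∂P := by
  have hi := integrable_rankOne hcont hnorm P
  have h1 := (((innerSL ℝ v).comp (ContinuousLinearMap.apply ℝ H w))).integral_comp_comm hi
  simp only [ContinuousLinearMap.comp_apply, ContinuousLinearMap.apply_apply,
    innerSL_apply_apply] at h1
  rw [kernelCovariance, ← h1]
  refine integral_congr_ae (Filter.Eventually.of_forall fun x => ?_)
  simp only [InnerProductSpace.rankOne_apply, real_inner_smul_right]
  rw [real_inner_comm v (φ x)]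
  ring

theorem inner_kernelCovariance_self [CompleteSpace H] (hcont : Continuous φ)
    (hnorm : ∀ x, ‖φ x‖ = 1) (P : Measure E) [IsFiniteMeasure P] (v : H) :
    ⟪v, kernelCovariance φ P v⟫_ℝ = ∫ x, ⟪v ⊗ₜ[ℝ] v, φ x ⊗ₜ[ℝ] φ x⟫_ℝ ∂P := by
  rw [inner_kernelCovariance_apply hcont hnorm]
  refine integral_congr_ae (Filter.Eventually.of_forall fun x => ?_)
  simp only [TensorProduct.inner_tmul, real_inner_comm]

theorem isSymmetric_kernelCovariance [CompleteSpace H] (hcont : Continuous φ)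
    (hnorm : ∀ x, ‖φ x‖ = 1) (P : Measure E) [IsFiniteMeasure P] :
    (kernelCovariance φ P : H →ₗ[ℝ] H).IsSymmetric := by
  intro v w
  change ⟪kernelCovariance φ P v, w⟫_ℝ = ⟪v, kernelCovariance φ P w⟫_ℝ
  rw [real_inner_comm, inner_kernelCovariance_apply hcont hnorm,
    inner_kernelCovariance_apply hcont hnorm]
  simp_rw [mul_comm]

theorem isCompactOperator_kernelCovariance [CompleteSpace H] (hcont : Continuous φ)
    (hnorm : ∀ x, ‖φ x‖ = 1) (P : Measure E) [IsProbabilityMeasure P] :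
    IsCompactOperator (kernelCovariance φ P) := by
  have hconv : Convex ℝ {f : H →L[ℝ] H | IsCompactOperator f} := fun f hf g hg a b _ _ _ =>
    (IsCompactOperator.smul (f := f) hf a).add (IsCompactOperator.smul (f := g) hg b)
  refine hconv.integral_mem isClosed_setOfPred_isCompactOperator
    (Filter.Eventually.of_forall fun x => ?_) (integrable_rankOne hcont hnorm P)
  have h1 : IsCompactOperator (ContinuousLinearMap.toSpanSingleton ℝ (φ x)) :=
    isCompactOperator_of_locallyCompactSpace_rng _
  change IsCompactOperator (InnerProductSpace.rankOne ℝ (φ x) (φ x))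
  rw [InnerProductSpace.rankOne_def']
  exact h1.comp_clm _

theorem sum_inner_kernelCovariance_le [CompleteSpace H] (hcont : Continuous φ)
    (hnorm : ∀ x, ‖φ x‖ = 1) (P : Measure E) [IsProbabilityMeasure P] {n : ℕ} {e : Fin n → H}
    (he : Orthonormal ℝ e) : ∑ i, ⟪e i, kernelCovariance φ P (e i)⟫_ℝ ≤ 1 := by
  simp_rw [inner_kernelCovariance_self hcont hnorm]
  rw [← integral_finsetSum _ fun i _ => integrable_inner_tmul_self hcont hnorm P _]
  have h1 : ∫ x, ∑ i, ⟪e i ⊗ₜ[ℝ] e i, φ x ⊗ₜ[ℝ] φ x⟫_ℝ ∂P ≤ ∫ _x, (1 : ℝ) ∂P := by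
    refine integral_mono (integrable_finsetSum _ fun i _ =>
      integrable_inner_tmul_self hcont hnorm P _) (integrable_const _) fun x => ?_
    have h2 := (he.isWeightedOrthonormal 0).sum_inner_sq_le Finset.univ (φ x)
    rw [hnorm] at h2
    simpa [TensorProduct.inner_tmul, sq] using h2
  simpa using h1

theorem inner_kernelCovariance_nonneg [CompleteSpace H] (hcont : Continuous φ)
    (hnorm : ∀ x, ‖φ x‖ = 1) (P : Measure E) [IsFiniteMeasure P] (v : H) :
    0 ≤ ⟪v, kernelCovariance φ P v⟫_ℝ := by
  rw [inner_kernelCovariance_apply hcont hnorm]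
  exact integral_nonneg fun x => mul_self_nonneg _

theorem inner_kernelCovariance_mixture [CompleteSpace H] (hcont : Continuous φ)
    (hnorm : ∀ x, ‖φ x‖ = 1) {k : ℕ} {ω : Fin k → ℝ} (hω : IsProbVector ω)
    (P : Fin k → Measure E) [∀ i, IsProbabilityMeasure (P i)] (v : H) :
    ⟪v, kernelCovariance φ (mixture ω P) v⟫_ℝ =
      ∑ i, ω i * ∫ x, ⟪v ⊗ₜ[ℝ] v, φ x ⊗ₜ[ℝ] φ x⟫_ℝ ∂P i := by
  have := isProbabilityMeasure_mixture hω P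
  rw [inner_kernelCovariance_self hcont hnorm, mixture, integral_finsetSum_measure]
  · refine Finset.sum_congr rfl fun i _ => ?_
    rw [integral_smul_measure, ENNReal.toReal_ofReal (hω.1 i), smul_eq_mul]
  · intro i _
    exact (integrable_inner_tmul_self hcont hnorm (P i) _).smul_measure ENNReal.ofReal_ne_top
end

/-! ### The Gaussian feature map and second moments -/

section
variable {d : ℕ} {H : Type*} [NormedAddCommGroup H] [InnerProductSpace ℝ H] {σ : ℝ}
  {φ : EuclideanSpace ℝ (Fin d) → H}

theorem IsFeatureMap.norm_eq_one (hφ : IsFeatureMap (gaussianKernel σ) φ)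
    (x : EuclideanSpace ℝ (Fin d)) : ‖φ x‖ = 1 := by
  have h := hφ x x
  rw [real_inner_self_eq_norm_sq] at h
  simp only [gaussianKernel, sub_self, norm_zero] at h
  have h1 : ‖φ x‖ ^ 2 = 1 := by
    rw [← h]
    simp
  exact (pow_eq_one_iff_of_nonneg (norm_nonneg _) two_ne_zero).1 h1

theorem IsFeatureMap.continuous (hφ : IsFeatureMap (gaussianKernel σ) φ) : Continuous φ := by
  rw [continuous_iff_continuousAt]
  intro y
  rw [ContinuousAt, tendsto_iff_norm_sub_tendsto_zero]
  have h1 : ∀ x, ‖φ x - φ y‖ = √(2 - 2 * gaussianKernel σ x y) := by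
    intro x
    rw [← Real.sqrt_sq (norm_nonneg (φ x - φ y)), norm_sub_sq_real, hφ.norm_eq_one,
      hφ.norm_eq_one, hφ x y]
    congr 1
    ring
  simp_rw [h1]
  have h2 : Continuous fun x => √(2 - 2 * gaussianKernel σ x y) := by
    unfold gaussianKernel
    fun_prop
  have h3 := h2.tendsto y
  simpa [gaussianKernel] using h3

theorem IsFeatureMap.inner_sq (hφ : IsFeatureMap (gaussianKernel σ) φ)
    (x y : EuclideanSpace ℝ (Fin d)) :
    ⟪φ x, φ y⟫_ℝ ^ 2 = Real.exp (-‖x - y‖ ^ 2 / σ ^ 2) := by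
  rw [← hφ x y, gaussianKernel, ← Real.exp_nat_mul]
  congr 1
  push_cast
  rw [mul_div_assoc', mul_div_mul_left _ _ two_ne_zero]

theorem IsFeatureMap.norm_tmul_self_sub_sq_le (hφ : IsFeatureMap (gaussianKernel σ) φ)
    (x y : EuclideanSpace ℝ (Fin d)) :
    ‖φ x ⊗ₜ[ℝ] φ x - φ y ⊗ₜ[ℝ] φ y‖ ^ 2 ≤ 2 * (‖x - y‖ ^ 2 / σ ^ 2) := by
  rw [norm_sub_sq_real, TensorProduct.norm_tmul, TensorProduct.norm_tmul,
    TensorProduct.inner_tmul, hφ.norm_eq_one, hφ.norm_eq_one, ← sq ⟪φ x, φ y⟫_ℝ,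
    hφ.inner_sq]
  have := Real.add_one_le_exp (-‖x - y‖ ^ 2 / σ ^ 2)
  rw [neg_div] at this ⊢
  linarith

theorem integrable_sub_norm_sq_and_integral_le {P : Measure (EuclideanSpace ℝ (Fin d))}
    [IsProbabilityMeasure P] {s : ℝ} (hs : totalVariance P ≤ ENNReal.ofReal (s ^ 2))
    (a : EuclideanSpace ℝ (Fin d)) :
    Integrable (fun x => ‖x - a‖ ^ 2) P ∧
      ∫ x, ‖x - a‖ ^ 2 ∂P ≤ s ^ 2 + ‖meanVector P - a‖ ^ 2 := by
  set m := meanVector P with hm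
  have hL2 : MemLp (fun x => x - m) 2 P := by
    refine ⟨by fun_prop, ?_⟩
    rw [eLpNorm_lt_top_iff_lintegral_rpow_enorm_lt_top two_ne_zero ENNReal.ofNat_ne_top]
    refine lt_of_le_of_lt ?_ (hs.trans_lt ENNReal.ofReal_lt_top)
    rw [totalVariance]
    refine le_of_eq (lintegral_congr fun x => ?_)
    simp [hm]
  have hint : Integrable (fun x => x - m) P := hL2.integrable one_le_two
  have hid : Integrable (fun x : EuclideanSpace ℝ (Fin d) => x) P := by
    refine (hint.add (integrable_const m)).congr (Filter.Eventually.of_forall fun x => ?_)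
    simp
  have hzero : ∫ x, (x - m) ∂P = 0 := by
    rw [integral_sub hid (integrable_const m)]
    simp [hm, meanVector]
  have hsq : Integrable (fun x => ‖x - m‖ ^ 2) P := hL2.integrable_norm_pow two_ne_zero
  have hinn : Integrable (fun x => 2 * ⟪x - m, m - a⟫_ℝ) P :=
    (hint.inner_const (m - a)).const_mul 2
  have hexp : (fun x => ‖x - a‖ ^ 2) =
      fun x => ‖x - m‖ ^ 2 + 2 * ⟪x - m, m - a⟫_ℝ + ‖m - a‖ ^ 2 := by
    funext x
    rw [← norm_add_sq_real, sub_add_sub_cancel]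
  have hvar : ∫ x, ‖x - m‖ ^ 2 ∂P ≤ s ^ 2 := by
    rw [integral_eq_lintegral_of_nonneg_ae (Filter.Eventually.of_forall fun x => sq_nonneg _)
      hsq.aestronglyMeasurable]
    refine ENNReal.toReal_le_of_le_ofReal (sq_nonneg s) (le_trans (le_of_eq ?_) hs)
    rw [totalVariance]
    refine lintegral_congr fun x => ?_
    rw [ENNReal.ofReal_pow (norm_nonneg _), ofReal_norm]
  have hcross : ∫ x, 2 * ⟪x - m, m - a⟫_ℝ ∂P = 0 := by
    rw [integral_const_mul]
    simp_rw [real_inner_comm (m - a)]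
    rw [integral_inner hint, hzero, inner_zero_right, mul_zero]
  rw [hexp]
  refine ⟨(hsq.add hinn).add (integrable_const _), ?_⟩
  have h1 := integral_add (hsq.add hinn) (integrable_const (‖m - a‖ ^ 2))
  have h2 := integral_add hsq hinn
  simp only [Pi.add_apply] at h1
  rw [h1, h2, hcross]
  simpa using hvar

/-- Replacing a distribution by a point mass at `a` changes the pairing with `F` by at most the
second moment about `a`; the product of norms is split by the arithmetic–geometric mean inequality
so that no square root of an integral occurs. -/
theorem IsFeatureMap.mul_integral_inner_sub_le (hφ : IsFeatureMap (gaussianKernel σ) φ)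
    {P : Measure (EuclideanSpace ℝ (Fin d))}
    [IsProbabilityMeasure P] {s : ℝ} (hs : totalVariance P ≤ ENNReal.ofReal (s ^ 2))
    (a : EuclideanSpace ℝ (Fin d)) (F : H ⊗[ℝ] H) (τ : ℝ) :
    τ * (∫ x, ⟪F, φ x ⊗ₜ[ℝ] φ x⟫_ℝ ∂P - ⟪F, φ a ⊗ₜ[ℝ] φ a⟫_ℝ) ≤
      ‖F‖ ^ 2 / 4 + τ ^ 2 * (2 * ((s ^ 2 + ‖meanVector P - a‖ ^ 2) / σ ^ 2)) := by
  obtain ⟨hint, hle⟩ := integrable_sub_norm_sq_and_integral_le hs a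
  have hF := integrable_inner_tmul_self hφ.continuous hφ.norm_eq_one P F
  have h1 : τ * (∫ x, ⟪F, φ x ⊗ₜ[ℝ] φ x⟫_ℝ ∂P - ⟪F, φ a ⊗ₜ[ℝ] φ a⟫_ℝ) =
      ∫ x, τ * (⟪F, φ x ⊗ₜ[ℝ] φ x⟫_ℝ - ⟪F, φ a ⊗ₜ[ℝ] φ a⟫_ℝ) ∂P := by
    rw [integral_const_mul, integral_sub hF (integrable_const _)]
    simp
  have hpt : ∀ x, τ * (⟪F, φ x ⊗ₜ[ℝ] φ x⟫_ℝ - ⟪F, φ a ⊗ₜ[ℝ] φ a⟫_ℝ) ≤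
      ‖F‖ ^ 2 / 4 + τ ^ 2 * 2 / σ ^ 2 * ‖x - a‖ ^ 2 := by
    intro x
    have h2 := hφ.norm_tmul_self_sub_sq_le x a
    have h0 : ⟪F, φ x ⊗ₜ[ℝ] φ x - φ a ⊗ₜ[ℝ] φ a⟫_ℝ =
        ⟪F, φ x ⊗ₜ[ℝ] φ x⟫_ℝ - ⟪F, φ a ⊗ₜ[ℝ] φ a⟫_ℝ := inner_sub_right F _ _
    rw [← h0]
    set D := φ x ⊗ₜ[ℝ] φ x - φ a ⊗ₜ[ℝ] φ a
    have h3 := abs_real_inner_le_norm F D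
    have h4 : τ * ⟪F, D⟫_ℝ ≤ |τ| * (‖F‖ * ‖D‖) := by
      refine (le_abs_self _).trans ?_
      rw [abs_mul]
      exact mul_le_mul_of_nonneg_left h3 (abs_nonneg τ)
    have h5 : |τ| * (‖F‖ * ‖D‖) ≤ ‖F‖ ^ 2 / 4 + τ ^ 2 * ‖D‖ ^ 2 := by
      rw [← sq_abs τ]
      nlinarith [sq_nonneg (‖F‖ / 2 - |τ| * ‖D‖)]
    have h6 := mul_le_mul_of_nonneg_left h2 (sq_nonneg τ)
    calc τ * ⟪F, D⟫_ℝ ≤ ‖F‖ ^ 2 / 4 + τ ^ 2 * (2 * (‖x - a‖ ^ 2 / σ ^ 2)) := by linarith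
      _ = _ := by ring
  rw [h1]
  calc ∫ x, τ * (⟪F, φ x ⊗ₜ[ℝ] φ x⟫_ℝ - ⟪F, φ a ⊗ₜ[ℝ] φ a⟫_ℝ) ∂P
      ≤ ∫ x, (‖F‖ ^ 2 / 4 + τ ^ 2 * 2 / σ ^ 2 * ‖x - a‖ ^ 2) ∂P :=
        integral_mono ((hF.sub (integrable_const _)).const_mul τ)
          ((integrable_const _).add (hint.const_mul _)) hpt
    _ = ‖F‖ ^ 2 / 4 + τ ^ 2 * 2 / σ ^ 2 * ∫ x, ‖x - a‖ ^ 2 ∂P := by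
        rw [integral_add (integrable_const _) (hint.const_mul _), integral_const_mul]
        simp
    _ ≤ ‖F‖ ^ 2 / 4 + τ ^ 2 * 2 / σ ^ 2 * (s ^ 2 + ‖meanVector P - a‖ ^ 2) := by
        gcongr
    _ = _ := by ring
end

/-! ### Comparison of eigenvalues and mixture weights -/

section
variable {H : Type*} [NormedAddCommGroup H] [InnerProductSpace ℝ H]

/-- Let `p = ∑ a i e i e iᵀ` be the part of `T` on its leading eigenvectors, `A = ∑ b j ψ j ψ jᵀ`
and `B = ∑ c j ψ j ψ jᵀ`, and let `J` be the pairing with `T`. If `T` is Hilbert–Schmidt close to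
`A - B`, then `p` is close to `A`, up to the overlap `⟪A, B⟫`: in
`‖p - A‖² = ⟪p - A, p - T⟫ + ⟪p - A, T - (A - B)⟫ - ⟪p, B⟫ + ⟪A, B⟫` one has `⟪p, p - T⟫ = 0`,
`⟪p, B⟫ ≥ 0`, and `-⟪A, p - T⟫` is at most `ε ∑ b j`. -/
theorem norm_sum_tmul_self_sub_sq_le {N k : ℕ} {T : H →L[ℝ] H} {J : H ⊗[ℝ] H →ₗ[ℝ] ℝ}
    (hJ : ∀ v, J (v ⊗ₜ[ℝ] v) = ⟪v, T v⟫_ℝ) {a : Fin N → ℝ} (ha0 : ∀ i, 0 ≤ a i) {e : Fin N → H}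
    (he : IsWeightedOrthonormal a e) (heig : ∀ i, T (e i) = a i • e i) {ε : ℝ}
    (hT : ∀ v, ⟪v, T v⟫_ℝ ≤ ∑ i, a i * ⟪e i, v⟫_ℝ ^ 2 + ε * ‖v‖ ^ 2) {b c : Fin k → ℝ}
    (hb : ∀ j, 0 ≤ b j) (hc : ∀ j, 0 ≤ c j) {ψ : Fin k → H} (hψ : ∀ j, ‖ψ j‖ = 1) {V : ℝ}
    (hV : ∀ F : H ⊗[ℝ] H,
      J F - ∑ j, (b j - c j) * ⟪F, ψ j ⊗ₜ[ℝ] ψ j⟫_ℝ ≤ ‖F‖ ^ 2 / 2 + V) :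
    ‖∑ i, a i • (e i ⊗ₜ[ℝ] e i) - ∑ j, b j • (ψ j ⊗ₜ[ℝ] ψ j)‖ ^ 2 ≤
      2 * (∑ i, ∑ j, b i * c j * ⟪ψ i, ψ j⟫_ℝ ^ 2) + 2 * V + 2 * ε * ∑ j, b j := by
  set p := ∑ i, a i • (e i ⊗ₜ[ℝ] e i) with hp
  set A := ∑ j, b j • (ψ j ⊗ₜ[ℝ] ψ j) with hA
  set B := ∑ j, c j • (ψ j ⊗ₜ[ℝ] ψ j) with hB
  have hAB : ⟪A, B⟫_ℝ = ∑ i, ∑ j, b i * c j * ⟪ψ i, ψ j⟫_ℝ ^ 2 := inner_sum_smul_tmul_self ..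
  have hpB : 0 ≤ ⟪p, B⟫_ℝ := by
    rw [hp, hB, inner_sum_smul_tmul_self]
    exact Finset.sum_nonneg fun i _ => Finset.sum_nonneg fun j _ =>
      mul_nonneg (mul_nonneg (ha0 i) (hc j)) (sq_nonneg _)
  have hpp : ⟪p, p⟫_ℝ = ∑ i, a i ^ 2 := by
    rw [← he.norm_sum_smul_tmul_self_sq]
    exact real_inner_self_eq_norm_sq p
  have hAp : ⟪A, p⟫_ℝ = ∑ j, b j * ∑ i, a i * ⟪e i, ψ j⟫_ℝ ^ 2 := by
    rw [hA, hp, inner_sum_smul_tmul_self]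
    refine Finset.sum_congr rfl fun j _ => ?_
    rw [Finset.mul_sum]
    refine Finset.sum_congr rfl fun i _ => ?_
    rw [real_inner_comm, mul_assoc]
  have hJp : J p = ∑ i, a i ^ 2 := by
    rw [hp, map_sum]
    refine Finset.sum_congr rfl fun i _ => ?_
    rw [map_smul, hJ, heig, real_inner_smul_right, real_inner_self_eq_norm_sq,
      he.weight_mul_norm_sq, smul_eq_mul, sq]
  have hJA : J A ≤ ⟪A, p⟫_ℝ + ε * ∑ j, b j := by
    rw [hAp, hA, map_sum, Finset.mul_sum, ← Finset.sum_add_distrib]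
    refine Finset.sum_le_sum fun j _ => ?_
    rw [map_smul, hJ, smul_eq_mul]
    have h1 := mul_le_mul_of_nonneg_left (hT (ψ j)) (hb j)
    rw [hψ] at h1
    linarith
  have hF := hV (p - A)
  rw [map_sub, hJp] at hF
  have hFAB : ∑ j, (b j - c j) * ⟪p - A, ψ j ⊗ₜ[ℝ] ψ j⟫_ℝ = ⟪p - A, A⟫_ℝ - ⟪p - A, B⟫_ℝ := by
    have h1 : ∀ f : Fin k → ℝ, ⟪p - A, ∑ j, f j • (ψ j ⊗ₜ[ℝ] ψ j)⟫_ℝ =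
        ∑ j, f j * ⟪p - A, ψ j ⊗ₜ[ℝ] ψ j⟫_ℝ := by
      intro f
      refine (inner_sum _ _ _).trans (Finset.sum_congr rfl fun j _ => ?_)
      exact real_inner_smul_right (p - A) (ψ j ⊗ₜ[ℝ] ψ j) (f j)
    rw [hA, hB, h1, h1, ← Finset.sum_sub_distrib]
    exact Finset.sum_congr rfl fun j _ => by ring
  have e1 : ⟪p - A, A⟫_ℝ = ⟪A, p⟫_ℝ - ⟪A, A⟫_ℝ := by
    refine (inner_sub_left _ _ _).trans ?_
    rw [real_inner_comm p A]
  have e2 : ⟪p - A, B⟫_ℝ = ⟪p, B⟫_ℝ - ⟪A, B⟫_ℝ := inner_sub_left _ _ _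
  have e3 : ‖p - A‖ ^ 2 = ⟪p, p⟫_ℝ - 2 * ⟪A, p⟫_ℝ + ⟪A, A⟫_ℝ := by
    rw [norm_sub_sq_real, ← real_inner_self_eq_norm_sq, ← real_inner_self_eq_norm_sq]
    congr 3
    exact real_inner_comm _ _
  rw [hFAB, e1, e2] at hF
  rw [← hAB]
  rw [e3] at hF ⊢
  linarith

/-- The comparison of the leading eigenvalues of `T` with the weights `b`, for `T` close to
`∑ (b j - c j) ψ j ψ jᵀ`. -/
theorem sum_eigenvalue_sub_sq_le [CompleteSpace H] {k : ℕ} {T : H →L[ℝ] H}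
    (hcomp : IsCompactOperator T)
    (hsymm : (T : H →ₗ[ℝ] H).IsSymmetric) {C : ℝ}
    (htr : ∀ (n : ℕ) (e : Fin n → H), Orthonormal ℝ e → ∑ i, ⟪e i, T (e i)⟫_ℝ ≤ C)
    {J : H ⊗[ℝ] H →ₗ[ℝ] ℝ} (hJ : ∀ v, J (v ⊗ₜ[ℝ] v) = ⟪v, T v⟫_ℝ) {b c : Fin k → ℝ}
    (hanti : Antitone b) (hb : ∀ j, 0 ≤ b j) (hc : ∀ j, 0 ≤ c j) {ψ : Fin k → H}
    (hψ : ∀ j, ‖ψ j‖ = 1) {V : ℝ}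
    (hV : ∀ F : H ⊗[ℝ] H,
      J F - ∑ j, (b j - c j) * ⟪F, ψ j ⊗ₜ[ℝ] ψ j⟫_ℝ ≤ ‖F‖ ^ 2 / 2 + V)
    {lam : ℕ → ℝ} (hlam : IsPosEigenvalueSeq T lam) :
    ∑ j : Fin k, (lam j - b j) ^ 2 ≤
      4 * V + 4 * (∑ i, ∑ j, b i * c j * ⟪ψ i, ψ j⟫_ℝ ^ 2) +
        2 * ∑ i, ∑ j, (if i = j then 0 else b i * b j * ⟪ψ i, ψ j⟫_ℝ ^ 2) := by
  obtain ⟨e, he, heig, hspan⟩ := hlam.exists_eigenvectors hcomp hsymm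
  obtain ⟨g, u, hganti, hg0, hu, hsum, hgb⟩ :=
    exists_spectral_decomposition_sum_smul_tmul_self hanti hb hψ
  have hb1 : 0 ≤ ∑ j, b j := Finset.sum_nonneg fun j _ => hb j
  refine le_of_forall_pos_le_add fun ε hε => ?_
  set ε' := ε / (4 * (∑ j, b j + 1)) with hε'
  have hε'pos : 0 < ε' := by positivity
  obtain ⟨N₀, hN₀⟩ := he.exists_forall_ge_lt htr heig hε'pos
  set N := max N₀ k with hN
  have hkN : k ≤ N := le_max_right _ _
  have hquad := fun v => he.inner_apply_le hlam.1 hcomp hsymm heig hspan hε'pos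
    (hN₀ N (le_max_left _ _)).le v
  have heN : IsWeightedOrthonormal (fun i : Fin N => lam i) (fun i : Fin N => e i) :=
    he.comp Fin.val_injective
  have h1 := norm_sum_tmul_self_sub_sq_le hJ (fun i => hlam.2.1 i) heN (fun i => heig i)
    (fun v => by
      rw [Fin.sum_univ_eq_sum_range (fun i => lam i * ⟪e i, v⟫_ℝ ^ 2) N]
      exact hquad v) hb hc hψ hV
  have h2 := sum_sub_sq_le_of_isWeightedOrthonormal hkN (a := fun i : Fin N => lam i)
    (hlam.1.comp_monotone fun i j h => h : Antitone fun i : Fin N => lam i)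
    (fun i => hlam.2.1 i) hganti hg0 heN hu
  rw [hsum, norm_sub_sq_real, heN.norm_sum_smul_tmul_self_sq, hu.norm_sum_smul_tmul_self_sq,
    inner_sum_smul_tmul_self] at h1
  have h3 : ∑ j : Fin k, (lam j - b j) ^ 2 ≤
      2 * ∑ j : Fin k, (lam j - g j) ^ 2 + 2 * ∑ j, (g j - b j) ^ 2 := by
    rw [Finset.mul_sum, Finset.mul_sum, ← Finset.sum_add_distrib]
    refine Finset.sum_le_sum fun j _ => ?_
    nlinarith [sq_nonneg ((lam j - g j) - (g j - b j))]
  have h4 : 4 * (ε' * ∑ j, b j) ≤ ε := by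
    rw [hε', div_mul_eq_mul_div, ← mul_div_assoc, div_le_iff₀ (by positivity)]
    nlinarith
  change ∑ j : Fin k, (lam j - g j) ^ 2 ≤ _ at h2
  linarith
end

theorem diffKernelCovariance_apply {E H : Type*} [MeasurableSpace E] [NormedAddCommGroup H]
    [InnerProductSpace ℝ H] (φ : E → H) (η : ℝ) (P Q : Measure E) (v : H) :
    diffKernelCovariance φ η P Q v = kernelCovariance φ P v - η • kernelCovariance φ Q v := rfl

/-- Only pairs `j < i` contribute to the overlap of the positive and the negative part of a
nonincreasing `c`, and each unordered pair contributes to the off-diagonal sum. -/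
theorem overlap_add_offdiag_le {k : ℕ} {c m : Fin k → ℝ} (hc : Antitone c) (hm : ∀ i, |c i| ≤ m i)
    (hc1 : ∀ i, c i ≤ 1) {K : Fin k → Fin k → ℝ} (hK : ∀ i j, 0 ≤ K i j)
    (hKs : ∀ i j, K i j = K j i) :
    4 * (∑ i, ∑ j, max (c i) 0 * max (-c j) 0 * K i j) +
        2 * ∑ i, ∑ j, (if i = j then 0 else max (c i) 0 * max (c j) 0 * K i j) ≤
      8 * ∑ i, ∑ j ∈ Finset.Iio i, m i * K i j := by
  have hp1 : ∀ i, max (c i) 0 ≤ 1 := fun i => max_le (hc1 i) zero_le_one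
  have hm0 : ∀ i, 0 ≤ m i := fun i => (abs_nonneg _).trans (hm i)
  have hpm : ∀ i, max (c i) 0 ≤ m i := fun i => max_le ((le_abs_self _).trans (hm i)) (hm0 i)
  have hnm : ∀ i, max (-c i) 0 ≤ m i := fun i => max_le ((neg_le_abs _).trans (hm i)) (hm0 i)
  have hB : ∑ i, ∑ j ∈ Finset.Iio i, m i * K i j =
      ∑ i, ∑ j, if j < i then m i * K i j else 0 := by
    refine Finset.sum_congr rfl fun i _ => ?_
    rw [← Finset.sum_filter]
    congr 1
    ext j
    simp
  have h1 : ∑ i, ∑ j, max (c i) 0 * max (-c j) 0 * K i j ≤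
      ∑ i, ∑ j, if j < i then m i * K i j else 0 := by
    rw [Finset.sum_comm]
    refine Finset.sum_le_sum fun i _ => Finset.sum_le_sum fun j _ => ?_
    split_ifs with h
    · rw [hKs j i]
      refine mul_le_mul_of_nonneg_right ?_ (hK i j)
      calc max (c j) 0 * max (-c i) 0 ≤ 1 * max (-c i) 0 :=
            mul_le_mul_of_nonneg_right (hp1 j) (le_max_right _ _)
        _ ≤ m i := by rw [one_mul]; exact hnm i
    · have h2 : c j ≤ c i := hc (not_lt.1 h)
      rcases le_total (c i) 0 with h3 | h3
      · rw [max_eq_right (h2.trans h3)]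
        simp
      · rw [max_eq_right (neg_nonpos.2 h3)]
        simp
  have h2 : ∑ i, ∑ j, (if i = j then 0 else max (c i) 0 * max (c j) 0 * K i j) ≤
      ∑ i, ∑ j, ((if j < i then m i * K i j else 0) + if i < j then m j * K j i else 0) := by
    refine Finset.sum_le_sum fun i _ => Finset.sum_le_sum fun j _ => ?_
    rcases lt_trichotomy i j with h | h | h
    · rw [if_neg h.ne, if_neg h.not_gt, if_pos h, zero_add, hKs j i]
      refine mul_le_mul_of_nonneg_right ?_ (hK i j)
      calc max (c i) 0 * max (c j) 0 ≤ 1 * max (c j) 0 :=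
            mul_le_mul_of_nonneg_right (hp1 i) (le_max_right _ _)
        _ ≤ m j := by rw [one_mul]; exact hpm j
    · simp [h]
    · rw [if_neg h.ne', if_pos h, if_neg h.not_gt, add_zero]
      refine mul_le_mul_of_nonneg_right ?_ (hK i j)
      calc max (c i) 0 * max (c j) 0 ≤ max (c i) 0 * 1 :=
            mul_le_mul_of_nonneg_left (hp1 j) (le_max_right _ _)
        _ ≤ m i := by rw [mul_one]; exact hpm i
  have h3 : ∑ i, ∑ j, (if i < j then m j * K j i else 0) =
      ∑ i, ∑ j, if j < i then m i * K i j else 0 := Finset.sum_comm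
  simp_rw [Finset.sum_add_distrib] at h2
  rw [h3] at h2
  have h4 : 0 ≤ ∑ i, ∑ j, if j < i then m i * K i j else 0 :=
    Finset.sum_nonneg fun i _ => Finset.sum_nonneg fun j _ => by
      split_ifs
      · exact mul_nonneg (hm0 i) (hK i j)
      · exact le_rfl
  rw [hB]
  linarith

theorem IsProbVector.le_one {k : ℕ} {ω : Fin k → ℝ} (hω : IsProbVector ω) (i : Fin k) :
    ω i ≤ 1 :=
  hω.2 ▸ Finset.single_le_sum (fun j _ => hω.1 j) (Finset.mem_univ i)

theorem theorem2 {d k : ℕ} {H : Type*} [NormedAddCommGroup H] [InnerProductSpace ℝ H]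
    [CompleteSpace H]
    (σ : ℝ) (hσ : 0 < σ)
    (φ : EuclideanSpace ℝ (Fin d) → H) (hφ : IsFeatureMap (gaussianKernel σ) φ)
    (η : ℝ) (hη : 1 ≤ η)
    (ω γ : Fin k → ℝ) (hω : IsProbVector ω) (hγ : IsProbVector γ)
    (hsort : Antitone fun i => ω i - η * γ i)
    (P Q : Fin k → Measure (EuclideanSpace ℝ (Fin d)))
    [∀ i, IsProbabilityMeasure (P i)] [∀ i, IsProbabilityMeasure (Q i)]
    (μ μ' δ : Fin k → EuclideanSpace ℝ (Fin d))
    (hμ : ∀ i, meanVector (P i) = μ i) (hμ' : ∀ i, meanVector (Q i) = μ' i)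
    (hδ : ∀ i, μ' i = μ i + δ i)
    (s : Fin k → ℝ)
    (hP : ∀ i, totalVariance (P i) ≤ ENNReal.ofReal (s i ^ 2))
    (hQ : ∀ i, totalVariance (Q i) ≤ ENNReal.ofReal (s i ^ 2)) :
    (∃ lam : ℕ → ℝ,
      IsPosEigenvalueSeq (diffKernelCovariance φ η (mixture ω P) (mixture γ Q)) lam) ∧
    ∀ lam : ℕ → ℝ,
      IsPosEigenvalueSeq (diffKernelCovariance φ η (mixture ω P) (mixture γ Q)) lam →
      ∑ i : Fin k, (lam i - max (ω i - η * γ i) 0) ^ 2 ≤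
        8 * ∑ i, (ω i * (‖δ i‖ ^ 2 / σ ^ 2) + (ω i + η ^ 2 * γ i) * (s i ^ 2 / σ ^ 2)) +
        16 * (1 + η) * ∑ i, ∑ j ∈ Finset.Iio i,
          (ω i + η * γ i) * Real.exp (-‖μ' i - μ' j‖ ^ 2 / σ ^ 2) := by
  have hcont := hφ.continuous
  have hnorm := hφ.norm_eq_one
  have hPm := isProbabilityMeasure_mixture hω P
  have hQm := isProbabilityMeasure_mixture hγ Q
  set T := diffKernelCovariance φ η (mixture ω P) (mixture γ Q) with hTdef
  have hTin : ∀ v, ⟪v, T v⟫_ℝ = ⟪v, kernelCovariance φ (mixture ω P) v⟫_ℝ -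
      η * ⟪v, kernelCovariance φ (mixture γ Q) v⟫_ℝ := by
    intro v
    rw [hTdef, diffKernelCovariance_apply, inner_sub_right, real_inner_smul_right]
  have hcomp : IsCompactOperator T :=
    (isCompactOperator_kernelCovariance hcont hnorm _).sub
      (IsCompactOperator.smul (f := kernelCovariance φ (mixture γ Q))
        (isCompactOperator_kernelCovariance hcont hnorm _) η)
  have hsymm : (T : H →ₗ[ℝ] H).IsSymmetric := by
    intro v w
    change ⟪T v, w⟫_ℝ = ⟪v, T w⟫_ℝ
    rw [hTdef, diffKernelCovariance_apply, diffKernelCovariance_apply, inner_sub_left,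
      inner_sub_right, real_inner_smul_left, real_inner_smul_right]
    have h1 := isSymmetric_kernelCovariance hcont hnorm (mixture ω P) v w
    have h2 := isSymmetric_kernelCovariance hcont hnorm (mixture γ Q) v w
    simp only [ContinuousLinearMap.coe_coe] at h1 h2
    rw [h1, h2]
  have htr : ∀ (n : ℕ) (e : Fin n → H), Orthonormal ℝ e → ∑ i, ⟪e i, T (e i)⟫_ℝ ≤ 1 := by
    intro n e he
    refine le_trans (Finset.sum_le_sum fun i _ => ?_)
      (sum_inner_kernelCovariance_le hcont hnorm (mixture ω P) he)
    rw [hTin]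
    have := mul_nonneg (zero_le_one.trans hη)
      (inner_kernelCovariance_nonneg hcont hnorm (mixture γ Q) (e i))
    linarith
  refine ⟨exists_isPosEigenvalueSeq hcomp hsymm htr, fun lam hlam => ?_⟩
  choose JP hJP using fun i => exists_linearMap_eq_integral hcont hnorm (P i)
  choose JQ hJQ using fun i => exists_linearMap_eq_integral hcont hnorm (Q i)
  set J : H ⊗[ℝ] H →ₗ[ℝ] ℝ := ∑ i, ω i • JP i - η • ∑ i, γ i • JQ i with hJdef
  have hJF : ∀ F, J F = ∑ i, ω i * JP i F - η * ∑ i, γ i * JQ i F := by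
    intro F
    simp [hJdef]
  have hJ : ∀ v, J (v ⊗ₜ[ℝ] v) = ⟪v, T v⟫_ℝ := by
    intro v
    rw [hTin, inner_kernelCovariance_mixture hcont hnorm hω,
      inner_kernelCovariance_mixture hcont hnorm hγ, hJF]
    simp_rw [hJP, hJQ]
  set c : Fin k → ℝ := fun i => ω i - η * γ i with hcdef
  have hV : ∀ F : H ⊗[ℝ] H,
      J F - ∑ j, (max (c j) 0 - max (-c j) 0) * ⟪F, φ (μ' j) ⊗ₜ[ℝ] φ (μ' j)⟫_ℝ ≤ ‖F‖ ^ 2 / 2 +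
        2 * ∑ i, (ω i * (‖δ i‖ ^ 2 / σ ^ 2) + (ω i + η ^ 2 * γ i) * (s i ^ 2 / σ ^ 2)) := by
    intro F
    have hPi : ∀ i, ω i * (JP i F - ⟪F, φ (μ' i) ⊗ₜ[ℝ] φ (μ' i)⟫_ℝ) ≤
        ω i * (‖F‖ ^ 2 / 4 + 2 * ((s i ^ 2 + ‖δ i‖ ^ 2) / σ ^ 2)) := by
      intro i
      have h1 := hφ.mul_integral_inner_sub_le (hP i) (μ' i) F 1
      have h2 : ‖μ i - μ' i‖ = ‖δ i‖ := by rw [hδ i, sub_add_cancel_left, norm_neg]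
      rw [hμ, h2, ← hJP] at h1
      refine mul_le_mul_of_nonneg_left ?_ (hω.1 i)
      linarith
    have hQi : ∀ i, γ i * (-η * (JQ i F - ⟪F, φ (μ' i) ⊗ₜ[ℝ] φ (μ' i)⟫_ℝ)) ≤
        γ i * (‖F‖ ^ 2 / 4 + η ^ 2 * (2 * (s i ^ 2 / σ ^ 2))) := by
      intro i
      have h1 := hφ.mul_integral_inner_sub_le (hQ i) (μ' i) F (-η)
      rw [hμ', sub_self, norm_zero, ← hJQ] at h1
      refine mul_le_mul_of_nonneg_left ?_ (hγ.1 i)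
      simpa using h1
    have hmain := Finset.sum_le_sum fun i (_ : i ∈ Finset.univ) => add_le_add (hPi i) (hQi i)
    have hl : J F - ∑ j, (max (c j) 0 - max (-c j) 0) * ⟪F, φ (μ' j) ⊗ₜ[ℝ] φ (μ' j)⟫_ℝ =
        ∑ i, (ω i * (JP i F - ⟪F, φ (μ' i) ⊗ₜ[ℝ] φ (μ' i)⟫_ℝ) +
          γ i * (-η * (JQ i F - ⟪F, φ (μ' i) ⊗ₜ[ℝ] φ (μ' i)⟫_ℝ))) := by
      rw [hJF, Finset.mul_sum, ← Finset.sum_sub_distrib, ← Finset.sum_sub_distrib]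
      refine Finset.sum_congr rfl fun i _ => ?_
      have : max (c i) 0 - max (-c i) 0 = c i := by
        rcases le_total (c i) 0 with h | h
        · rw [max_eq_right h, max_eq_left (neg_nonneg.2 h)]; ring
        · rw [max_eq_left h, max_eq_right (neg_nonpos.2 h)]; ring
      rw [this, hcdef]
      ring
    have hr : ∑ i, (ω i * (‖F‖ ^ 2 / 4 + 2 * ((s i ^ 2 + ‖δ i‖ ^ 2) / σ ^ 2)) +
          γ i * (‖F‖ ^ 2 / 4 + η ^ 2 * (2 * (s i ^ 2 / σ ^ 2)))) = ‖F‖ ^ 2 / 2 +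
        2 * ∑ i, (ω i * (‖δ i‖ ^ 2 / σ ^ 2) + (ω i + η ^ 2 * γ i) * (s i ^ 2 / σ ^ 2)) := by
      have h1 : ‖F‖ ^ 2 / 2 = ∑ i, (ω i * (‖F‖ ^ 2 / 4) + γ i * (‖F‖ ^ 2 / 4)) := by
        rw [Finset.sum_add_distrib, ← Finset.sum_mul, ← Finset.sum_mul, hω.2, hγ.2]
        ring
      rw [h1, Finset.mul_sum, ← Finset.sum_add_distrib]
      exact Finset.sum_congr rfl fun i _ => by ring
    rw [hl]
    exact hmain.trans_eq hr
  have hmain := sum_eigenvalue_sub_sq_le hcomp hsymm htr hJ (b := fun i => max (c i) 0)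
    (c := fun i => max (-c i) 0) (fun i j hij => max_le_max_right 0 (hsort hij))
    (fun _ => le_max_right _ _) (fun _ => le_max_right _ _) (fun j => hnorm (μ' j)) hV hlam
  have hη0 : 0 ≤ η := zero_le_one.trans hη
  have hm0 : ∀ i, 0 ≤ ω i + η * γ i := fun i => add_nonneg (hω.1 i) (mul_nonneg hη0 (hγ.1 i))
  have hpairs := overlap_add_offdiag_le hsort (m := fun i => ω i + η * γ i)
    (fun i => abs_le.2 ⟨by linarith [hω.1 i], by linarith [mul_nonneg hη0 (hγ.1 i)]⟩)
    (fun i => by linarith [hω.le_one i, mul_nonneg hη0 (hγ.1 i)])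
    (K := fun i j => Real.exp (-‖μ' i - μ' j‖ ^ 2 / σ ^ 2)) (fun i j => (Real.exp_pos _).le)
    (fun i j => by rw [norm_sub_rev])
  simp_rw [hφ.inner_sq] at hmain
  have hB : 0 ≤ ∑ i, ∑ j ∈ Finset.Iio i,
      (ω i + η * γ i) * Real.exp (-‖μ' i - μ' j‖ ^ 2 / σ ^ 2) :=
    Finset.sum_nonneg fun i _ => Finset.sum_nonneg fun j _ =>
      mul_nonneg (hm0 i) (Real.exp_pos _).le
  have hηB := mul_nonneg hη0 hB
  linarith
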